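/- Let $\mathbb{S}^n$ be the space of real symmetric $n\times n$ matrices with the trace inner product and Frobenius norm, $\mathbb{S}^n_+$ its cone of positive semidefinite matrices, and let $\mathbb{Y},\mathbb{W}$ be finite dimensional real Euclidean spaces. Let $\mathcal{F}:\mathbb{S}^n\to\mathbb{W}$ and $\mathcal{A}:\mathbb{S}^n\to\mathbb{Y}$ be linear, $\mathcal{Q}\subseteq\mathbb{Y}$ a convex polyhedral cone with polar $\mathcal{Q}^\circ$, $C\in\mathbb{S}^n$, $b\in\mathbb{Y}$, and let $h:\mathbb{W}\to(-\infty,+\infty]$ have a non-empty open convex domain $\mathrm{dom}(h)=\{h<\infty\}$, on which $h$ is continuously differentiable and strictly convex. Consider the convex SDP $$\min_X\ \theta(X):=h(\mathcal{F}X)+\langle C,X\rangle+\delta_{\mathbb{S}^n_+}(X)\quad\text{s.t.}\quad b-\mathcal{A}X\in\mathcal{Q}^\circ ,$$ where $\delta_D$ denotes the indicator function of $D$, and let $\Omega$ be its set of optimal solutions (feasible points with finite, minimal objective value). For $(y,w,S)\in\mathbb{Y}\times\mathbb{W}\times\mathbb{S}^n$ and $X\in\mathbb{S}^n$ put $$l(y,w,S;X)=\delta_{\mathcal{Q}}(y)-\langle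 b,y\rangle+h^*(-w)+\delta_{\mathbb{S}^n_+}(S)+\langle X,\mathcal{A}^*y+\mathcal{F}^*w+S-C\rangle ,$$ where $h^*$ is the convex conjugate of $h$; let $\phi(X)=\inf_{y,w,S}l(y,w,S;X)$, which is concave, and $\mathcal{T}_\phi(X)=-\partial\phi(X)$, where $\partial\phi$ is the superdifferential. Let $\mathcal{M}_\phi(X)$ be the set of $(y,w,S)$ that satisfy the KKT system $$0\in-b+\mathcal{A}X+\mathcal{N}_{\mathcal{Q}}(y),\quad 0\in\mathcal{F}X-\partial h^*(-w),\quad 0\in X+\mathcal{N}_{\mathbb{S}^n_+}(S),\quad 0=C-(\mathcal{A}^*y+\mathcal{F}^*w+S),$$ where $\mathcal{N}_D$ denotes the normal cone of a convex set $D$. Assume that for every $w\in\mathrm{dom}(h)$ there are $\kappa>0$ and a neighbourhood $\mathcal{W}$ of $w$ with $$h(w')\ge h(w)+\langle\nabla h(w),w'-w\rangle+\kappa\|w'-w\|^2\qquad\text{for all } w'\in\mathcal{W},$$ and that one of the following two conditions holds: (i) there are $\overline X\in\Omega$ and $(\bar y,\bar w,\overline S)\in\mathcal{M}_\phi(\overline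 X)$ with $\mathrm{rank}(\overline S)\ge n-1$; (ii) there are $\overline X\in\Omega$ and $(\bar y,\bar w,\overline S)\in\mathcal{M}_\phi(\overline X)$ with $\mathrm{rank}(\overline X)+\mathrm{rank}(\overline S)=n$. Then $\mathcal{T}_\phi^{-1}(0)=\Omega$, and for every $X\in\Omega$ both of the following (equivalent) properties hold: $\mathcal{T}_\phi$ is metrically subregular at $X$ for the origin, i.e. $0\in\mathcal{T}_\phi(X)$ and there are $\kappa>0$ and a neighbourhood $\mathcal{U}$ of $X$ with $$\mathrm{dist}(X',\mathcal{T}_\phi^{-1}(0))\le\kappa\,\mathrm{dist}(0,\mathcal{T}_\phi(X'))\qquad\text{for all } X'\in\mathcal{U}$$ (the distance to the empty set being $+\infty$); and quadratic growth holds at $X$ with respect to $\Omega$, i.e. there are $\kappa>0$ and a neighbourhood $\mathcal{U}$ of $X$ with $$\theta(X')\ge\theta(X)+\kappa\,\mathrm{dist}^2(X',\Omega)\qquad\text{for all } X'\in\mathcal{U} \text{ with } b-\mathcal{A}X'\in\mathcal{Q}^\circ .$$ -/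

import Mathlib

open scoped Topology RealInnerProductSpace

noncomputable section

namespace ConvexSDP

/-- The space `𝕊ⁿ` of real symmetric `n × n` matrices, as a subspace of the Euclidean space of all
`n × n` arrays. Its inner product is the trace inner product and its norm the Frobenius norm. -/
def symSubmodule (n : ℕ) : Submodule ℝ (EuclideanSpace ℝ (Fin n × Fin n)) where
  carrier := {x | ∀ i j, x (i, j) = x (j, i)}
  add_mem' := by
    intro a b ha hb i j
    simp [ha i j, hb i j]
  zero_mem' := by
    intro i j
    simp
  smul_mem' := by
    intro c x hx i j
    simp [hx i j]

/-- `𝕊ⁿ` with the trace inner product. -/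
abbrev SymMat (n : ℕ) : Type := symSubmodule n

/-- The matrix with the given entries. -/
def SymMat.toMatrix {n : ℕ} (X : SymMat n) : Matrix (Fin n) (Fin n) ℝ :=
  Matrix.of fun i j => X.1 (i, j)

theorem SymMat.inner_eq_trace {n : ℕ} (X Y : SymMat n) :
    ⟪X, Y⟫ = (X.toMatrix.transpose * Y.toMatrix).trace := by
  rw [Submodule.coe_inner, PiLp.inner_apply, Fintype.sum_prod_type, Finset.sum_comm]
  simp [SymMat.toMatrix, Matrix.trace, Matrix.mul_apply, mul_comm]

/-- The cone `𝕊ⁿ₊` of positive semidefinite matrices. -/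
def psdCone (n : ℕ) : Set (SymMat n) := {X | X.toMatrix.PosSemidef}

section ConvexAnalysis

variable {E : Type*} [NormedAddCommGroup E] [InnerProductSpace ℝ E]

/-- The indicator function `δ_D`. -/
def indicatorFn (D : Set E) (x : E) : EReal :=
  open Classical in if x ∈ D then 0 else ⊤

/-- The effective domain. -/
def effDomain (f : E → EReal) : Set E := {x | f x < ⊤}

/-- The conjugate `f*(u) = sup_x (⟨x, u⟩ - f x)`. -/
def conjugate (f : E → EReal) (u : E) : EReal := ⨆ x, ((⟪x, u⟫ : ℝ) : EReal) - f x

/-- The subdifferential of a convex function. -/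
def subdifferential (f : E → EReal) (x : E) : Set E :=
  {v | ∀ x', f x + ((⟪v, x' - x⟫ : ℝ) : EReal) ≤ f x'}

/-- The (super)differential of a concave function. -/
def superdifferential (f : E → EReal) (x : E) : Set E :=
  {v | ∀ x', f x' ≤ f x + ((⟪v, x' - x⟫ : ℝ) : EReal)}

/-- The normal cone of a convex set; it is empty at points outside the set. -/
def normalCone (D : Set E) (x : E) : Set E := {v | x ∈ D ∧ ∀ d ∈ D, ⟪v, d - x⟫ ≤ 0}

/-- The polar `D°` of a cone. -/
def polarCone (D : Set E) : Set E := {x | ∀ d ∈ D, ⟪x, d⟫ ≤ 0}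

/-- Convex polyhedral cones: finite intersections of closed half-spaces through the origin. -/
def IsPolyhedralCone (D : Set E) : Prop :=
  ∃ s : Finset E, D = {x | ∀ a ∈ s, ⟪a, x⟫ ≤ 0}

end ConvexAnalysis

/-- Metric subregularity of a multi-valued mapping `T` at `x` for `y`: `y ∈ T x`, and
`dist(x', T⁻¹(y)) ≤ κ dist(y, T x')` near `x`. The distance to the empty set is `∞`. -/
def MetricallySubregularAt {E G : Type*} [PseudoEMetricSpace E] [PseudoEMetricSpace G]
    (T : E → Set G) (x : E) (y : G) : Prop :=
  y ∈ T x ∧ ∃ κ : NNReal, 0 < κ ∧ ∃ U ∈ 𝓝 x, ∀ x' ∈ U,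
    Metric.infEDist x' {z | y ∈ T z} ≤ (κ : ENNReal) * Metric.infEDist y (T x')

variable {n : ℕ} {Y W : Type*} [NormedAddCommGroup Y] [InnerProductSpace ℝ Y]
  [FiniteDimensional ℝ Y] [NormedAddCommGroup W] [InnerProductSpace ℝ W] [FiniteDimensional ℝ W]

/-- The data of the problem
`min h(F X) + ⟨C, X⟩ + δ_{𝕊ⁿ₊}(X)` subject to `b - A X ∈ Q°`. -/
structure Problem (n : ℕ) (Y W : Type*) [NormedAddCommGroup Y] [InnerProductSpace ℝ Y]
    [NormedAddCommGroup W] [InnerProductSpace ℝ W] where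
  h : W → EReal
  F : SymMat n →ₗ[ℝ] W
  A : SymMat n →ₗ[ℝ] Y
  Q : Set Y
  C : SymMat n
  b : Y

namespace Problem

/-- The standing assumptions: `Q` is a convex polyhedral cone, and `h` takes values in `(-∞, ∞]`,
its domain is non-empty, open and convex, and on it `h` is continuously differentiable and strictly
convex (convexity of the domain is part of `StrictConvexOn`). -/
structure IsAdmissible (P : Problem n Y W) : Prop where
  polyhedral : IsPolyhedralCone P.Q
  ne_bot : ∀ w, P.h w ≠ ⊥
  dom_nonempty : (effDomain P.h).Nonempty
  dom_open : IsOpen (effDomain P.h)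
  contDiff : ContDiffOn ℝ 1 (fun w => (P.h w).toReal) (effDomain P.h)
  strictConvex : StrictConvexOn ℝ (effDomain P.h) (fun w => (P.h w).toReal)

/-- The local quadratic growth condition on `h`: at every `w` in the domain there are `κ > 0` and a
neighbourhood on which `h(w') ≥ h(w) + ⟨∇h(w), w' - w⟩ + κ ‖w' - w‖²`. -/
def LocalGrowth (P : Problem n Y W) : Prop :=
  ∀ w ∈ effDomain P.h, ∃ κ : ℝ, 0 < κ ∧ ∃ N ∈ 𝓝 w, ∀ w' ∈ N,
    P.h w + ((fderiv ℝ (fun u => (P.h u).toReal) w (w' - w) + κ * ‖w' - w‖ ^ 2 : ℝ) : EReal)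
      ≤ P.h w'

/-- The objective `θ(X) = h(F X) + ⟨C, X⟩ + δ_{𝕊ⁿ₊}(X)`. -/
def objective (P : Problem n Y W) (X : SymMat n) : EReal :=
  P.h (P.F X) + ((⟪P.C, X⟫ : ℝ) : EReal) + indicatorFn (psdCone n) X

/-- The set of `X` with `b - A X ∈ Q°`. -/
def constraintSet (P : Problem n Y W) : Set (SymMat n) := {X | P.b - P.A X ∈ polarCone P.Q}

/-- The set of optimal solutions of the primal problem. -/
def solutionSet (P : Problem n Y W) : Set (SymMat n) :=
  {X | X ∈ P.constraintSet ∧ P.objective X < ⊤ ∧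
    ∀ X' ∈ P.constraintSet, P.objective X ≤ P.objective X'}

/-- The Lagrangian of the dual problem
`min δ_Q(y) - ⟨b, y⟩ + h*(-w) + δ_{𝕊ⁿ₊}(S)` subject to `A* y + F* w + S = C`. -/
def lagrangian (P : Problem n Y W) (z : Y × W × SymMat n) (X : SymMat n) : EReal :=
  indicatorFn P.Q z.1 + ((-⟪P.b, z.1⟫ : ℝ) : EReal) + conjugate P.h (-z.2.1)
    + indicatorFn (psdCone n) z.2.2
    + ((⟪X, LinearMap.adjoint P.A z.1 + LinearMap.adjoint P.F z.2.1 + z.2.2 - P.C⟫ : ℝ) : EReal)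

/-- `φ(X) = inf_z l(z, X)`, a concave function. -/
def phi (P : Problem n Y W) (X : SymMat n) : EReal := ⨅ z, P.lagrangian z X

/-- `T_φ(X) = -∂φ(X)`. -/
def Tphi (P : Problem n Y W) (X : SymMat n) : Set (SymMat n) :=
  {V | -V ∈ superdifferential P.phi X}

/-- `M_φ(X)`: the triples `(y, w, S)` such that `(y, w, S, X)` solves the KKT system
`0 ∈ -b + A X + N_Q(y)`, `0 ∈ F X - ∂h*(-w)`, `0 ∈ X + N_{𝕊ⁿ₊}(S)`,
`0 = C - (A* y + F* w + S)`. -/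
def multipliers (P : Problem n Y W) (X : SymMat n) : Set (Y × W × SymMat n) :=
  {z | P.b - P.A X ∈ normalCone P.Q z.1 ∧
    P.F X ∈ subdifferential (conjugate P.h) (-z.2.1) ∧
    -X ∈ normalCone (psdCone n) z.2.2 ∧
    P.C - (LinearMap.adjoint P.A z.1 + LinearMap.adjoint P.F z.2.1 + z.2.2) = 0}

/-- The second order growth condition at `X` with respect to the set of optimal solutions. -/
def QuadraticGrowthAt (P : Problem n Y W) (X : SymMat n) : Prop :=
  ∃ κ : ℝ, 0 < κ ∧ ∃ U ∈ 𝓝 X, ∀ X' ∈ U ∩ P.constraintSet,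
    P.objective X + ((κ * Metric.infDist X' P.solutionSet ^ 2 : ℝ) : EReal) ≤ P.objective X'

end Problem

end ConvexSDP

end

/-! Fix one KKT point (Xb, y, w, S), so that ∇h(F Xb) = -w. For feasible X the optimality gap splits
into three nonnegative terms (`IsKKT.realObjective_sub`): the excess of h over its tangent at F Xb,
the slack -⟨y, b - A X⟩, and ⟨S, X⟩. The first dominates κ‖F X - F Xb‖² near F Xb. Quadratic growth
therefore reduces to an error bound (`IsKKT.exists_infDist_sq_le`): on bounded sets, dist²(X, Ω) is
at most a constant times ‖F X - F Xb‖² - ⟨y, b - A X⟩ + ⟨S, X⟩.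

The error bound moves X into Ω in three stages. With p the projection onto ker S, the matrix p X p
lies in the face of 𝕊ⁿ₊ exposed by S, and its squared distance to X is O(⟨S, X⟩)
(`norm_sub_conj_sq_le`). Hoffman's bound then corrects p X p inside the span of that face so as to
meet the remaining optimality conditions, which are polyhedral, at a cost linear in the residuals
(`IsKKT.exists_polyhedral_error_bound`). This may destroy semidefiniteness, which is recovered by
moving towards Xb (`FaceRegular`). Only here do the rank conditions enter: under strict
complementarity Xb is a relative interior point of the face, and if rank S ≥ n - 1 the face is a ray
or {0}.

On the dual side, φ = -θ at feasible points with F X ∈ dom h, and φ = -∞ where X ∉ 𝕊ⁿ₊ or b - A X ∉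
Q°. Since h need not be lower semicontinuous, φ may be finite although F X ∉ dom h; comparison along
the segment to Xb shows that no maximizer is of this kind (`IsKKT.map_F_eq_of_le_phi`), whence
T_φ⁻¹(0) = Ω. For V ∈ T_φ(X) and d = dist(X, Ω), growth and the supergradient inequality give κ d² ≤
‖V‖ d, which is metric subregularity. -/

namespace ConvexSDP

/-! ### Polyhedral error bounds: Hoffman's lemma and Farkas' lemma. -/

section Hoffman

/-- A linear map that is injective on a closed cone is bounded below there. -/
theorem exists_norm_le_mul_norm_of_closed_cone {E G : Type*} [NormedAddCommGroup E]
    [NormedSpace ℝ E] [FiniteDimensional ℝ E] [NormedAddCommGroup G] [NormedSpace ℝ G]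
    (B : E →ₗ[ℝ] G) {K : Set E} (hK : IsClosed K) (hcone : ∀ t : ℝ, 0 ≤ t → ∀ w ∈ K, t • w ∈ K)
    (hinj : ∀ w ∈ K, B w = 0 → w = 0) :
    ∃ c : ℝ, 0 ≤ c ∧ ∀ w ∈ K, ‖w‖ ≤ c * ‖B w‖ := by
  have : ProperSpace E := FiniteDimensional.proper ℝ E
  have hBc : Continuous B := B.continuous_of_finiteDimensional
  -- By homogeneity it suffices to bound ‖B w‖ from below on the compact unit slice of K.
  have hcomp : IsCompact (Metric.sphere (0 : E) 1 ∩ K) := (isCompact_sphere 0 1).inter_right hK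
  have hnorm : ∀ w ∈ K, w ≠ 0 → ‖w‖⁻¹ • w ∈ Metric.sphere (0 : E) 1 ∩ K := fun w hw hw0 =>
    ⟨by simp [norm_smul, hw0], hcone _ (by positivity) w hw⟩
  rcases (Metric.sphere (0 : E) 1 ∩ K).eq_empty_or_nonempty with he | hne
  · refine ⟨0, le_rfl, fun w hw => ?_⟩
    by_cases hw0 : w = 0
    · simp [hw0]
    · have := hnorm w hw hw0
      rw [he] at this
      exact this.elim
  · obtain ⟨w₀, ⟨hw₀s, hw₀K⟩, hmin⟩ := hcomp.exists_isMinOn hne (hBc.norm.continuousOn)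
    have hpos : 0 < ‖B w₀‖ := by
      refine norm_pos_iff.2 fun h => ?_
      have h0 := hinj w₀ hw₀K h
      simp [h0] at hw₀s
    refine ⟨‖B w₀‖⁻¹, by positivity, fun w hw => ?_⟩
    by_cases hw0 : w = 0
    · simp [hw0]
    · have h1 : ‖B w₀‖ ≤ ‖B (‖w‖⁻¹ • w)‖ := hmin (hnorm w hw hw0)
      have hw1 : 0 < ‖w‖ := norm_pos_iff.2 hw0
      rw [map_smul, norm_smul, norm_inv, norm_norm, inv_mul_eq_div, le_div_iff₀ hw1] at h1
      rw [inv_mul_eq_div, le_div_iff₀ hpos]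
      linarith

variable {ι : Type*}

/-- The vectors all of whose coordinates have the prescribed signs (or vanish). -/
def signCone (σ : ι → SignType) : Set (EuclideanSpace ℝ ι) :=
  {w | ∀ i, 0 ≤ (σ i : ℝ) * w i ∧ (σ i = 0 → w i = 0)}

theorem isClosed_signCone (σ : ι → SignType) : IsClosed (signCone σ) := by
  have : signCone σ = ⋂ i, ({w : EuclideanSpace ℝ ι | 0 ≤ (σ i : ℝ) * w i} ∩
      {w | σ i = 0 → w i = 0}) := by
    ext w; simp [signCone, Set.mem_iInter]
  rw [this]
  refine isClosed_iInter fun i => IsClosed.inter ?_ ?_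
  · exact isClosed_le continuous_const (by fun_prop)
  · by_cases h : σ i = 0
    · simp only [h, true_imp_iff]
      exact isClosed_eq (by fun_prop) continuous_const
    · simp [h]

theorem mem_signCone_sign (w : EuclideanSpace ℝ ι) : w ∈ signCone fun i => SignType.sign (w i) := by
  intro i
  refine ⟨?_, fun h => sign_eq_zero_iff.1 h⟩
  rw [sign_mul_self]
  exact abs_nonneg _

variable [Fintype ι] {G : Type*} [NormedAddCommGroup G] [NormedSpace ℝ G]

/-- Hoffman's error bound: solutions of a linear system with sign constraints on the variables
in `I` can be chosen at a distance controlled by the residual. -/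
theorem exists_hoffman_constant (B : EuclideanSpace ℝ ι →ₗ[ℝ] G) (I : Set ι) :
    ∃ c : ℝ, 0 ≤ c ∧ ∀ u v : EuclideanSpace ℝ ι, (∀ i ∈ I, 0 ≤ u i) → (∀ i ∈ I, 0 ≤ v i) →
      ∃ v' : EuclideanSpace ℝ ι, (∀ i ∈ I, 0 ≤ v' i) ∧ B v' = B v ∧
        ‖v' - u‖ ≤ c * ‖B v - B u‖ := by
  classical
  have key : ∀ σ : ι → SignType, ∃ c : ℝ, 0 ≤ c ∧ ((∀ w ∈ signCone σ, B w = 0 → w = 0) →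
      ∀ w ∈ signCone σ, ‖w‖ ≤ c * ‖B w‖) := by
    intro σ
    by_cases h : ∀ w ∈ signCone σ, B w = 0 → w = 0
    · obtain ⟨c, hc, hcw⟩ := exists_norm_le_mul_norm_of_closed_cone B (isClosed_signCone σ)
        (fun t ht w hw i => ⟨by
          have := mul_nonneg ht (hw i).1
          simp only [PiLp.smul_apply, smul_eq_mul]
          linarith, fun h0 => by simp [(hw i).2 h0]⟩) h
      exact ⟨c, hc, fun _ => hcw⟩
    · exact ⟨0, le_rfl, fun h' => absurd h' h⟩
  choose c hc hcw using key
  refine ⟨∑ σ, c σ, Finset.sum_nonneg fun σ _ => hc σ, fun u v hu hv => ?_⟩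
  have hBc : Continuous B := B.continuous_of_finiteDimensional
  set s : Set (EuclideanSpace ℝ ι) := {x | (∀ i ∈ I, 0 ≤ x i) ∧ B x = B v} with hs
  have hsc : IsClosed s := by
    have : s = (⋂ i ∈ I, {x : EuclideanSpace ℝ ι | 0 ≤ x i}) ∩ {x | B x = B v} := by
      ext x; simp [hs]
    rw [this]
    refine IsClosed.inter (isClosed_biInter fun i _ => isClosed_le continuous_const (by fun_prop))
      (isClosed_eq hBc continuous_const)
  -- Since x is a nearest point to u, the sign cone of x - u contains no nonzero kernel vector of B,
  -- and the constant of that pattern applies to x - u.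
  obtain ⟨x, hxs, hx⟩ := hsc.exists_infDist_eq_dist ⟨v, hv, rfl⟩ u
  refine ⟨x, hxs.1, hxs.2, ?_⟩
  set w := x - u with hw
  have hinj : ∀ α ∈ signCone (fun i => SignType.sign (w i)), B α = 0 → α = 0 := by
    intro α hα hBα
    by_contra hne
    -- moving from `x` against `α` stays feasible and gets closer to `u`
    have hε : ∃ ε : ℝ, 0 < ε ∧ ∀ i, ε * |α i| ≤ |w i| := by
      have : ∀ i, ∃ ε : ℝ, 0 < ε ∧ ε * |α i| ≤ |w i| := by
        intro i
        by_cases hwi : w i = 0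
        · exact ⟨1, one_pos, by simp [(hα i).2 (sign_eq_zero_iff.2 hwi)]⟩
        · refine ⟨|w i| / (|α i| + 1), div_pos (abs_pos.2 hwi) (by positivity), ?_⟩
          rw [div_mul_eq_mul_div, div_le_iff₀ (by positivity)]
          nlinarith [abs_nonneg (w i), abs_nonneg (α i)]
      choose ε hεp hεi using this
      by_cases hι : Nonempty ι
      · refine ⟨Finset.univ.inf' Finset.univ_nonempty ε, ?_, fun i => ?_⟩
        · rw [Finset.lt_inf'_iff]; exact fun i _ => hεp i
        · exact (mul_le_mul_of_nonneg_right (Finset.inf'_le _ (Finset.mem_univ i))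
            (abs_nonneg _)).trans (hεi i)
      · exact ⟨1, one_pos, fun i => (hι ⟨i⟩).elim⟩
    obtain ⟨ε, hεp, hεi⟩ := hε
    have hsgn : ∀ i, (0 ≤ w i ∧ 0 ≤ α i) ∨ (w i ≤ 0 ∧ α i ≤ 0) := by
      intro i
      have h1 : 0 ≤ (SignType.sign (w i) : ℝ) * α i ∧ (SignType.sign (w i) = 0 → α i = 0) := hα i
      rcases lt_trichotomy (w i) 0 with h | h | h
      · right
        rw [sign_neg h] at h1
        simp only [SignType.coe_neg_one, neg_one_mul] at h1
        exact ⟨h.le, neg_nonneg.1 h1.1⟩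
      · left
        rw [h] at h1 ⊢
        exact ⟨le_rfl, (h1.2 sign_zero).ge⟩
      · left
        rw [sign_pos h] at h1
        simp only [SignType.coe_one, one_mul] at h1
        exact ⟨h.le, h1.1⟩
    have hmem : x - ε • α ∈ s := by
      refine ⟨fun i hi => ?_, by rw [map_sub, map_smul, hBα, smul_zero, sub_zero, hxs.2]⟩
      have h1 := hεi i
      have hwi : w i = x i - u i := by simp [hw]
      have hui := hu i hi
      have hxi := hxs.1 i hi
      simp only [PiLp.sub_apply, PiLp.smul_apply, smul_eq_mul]
      rcases hsgn i with ⟨h2, h3⟩ | ⟨h2, h3⟩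
      · rw [abs_of_nonneg h2, abs_of_nonneg h3] at h1
        linarith
      · nlinarith
    have hle : ‖w‖ ≤ ‖w - ε • α‖ := by
      have h1 : Metric.infDist u s ≤ dist u (x - ε • α) := Metric.infDist_le_dist_of_mem hmem
      rw [hx, dist_comm, dist_comm u, dist_eq_norm, dist_eq_norm] at h1
      rwa [hw, sub_right_comm]
    have hsq : ‖w‖ ^ 2 ≤ ‖w - ε • α‖ ^ 2 := by gcongr
    rw [EuclideanSpace.norm_sq_eq, EuclideanSpace.norm_sq_eq] at hsq
    obtain ⟨j, hj⟩ : ∃ j, α j ≠ 0 := by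
      by_contra! h
      exact hne (by ext i; simp [h i])
    refine absurd hsq (not_le.2 (Finset.sum_lt_sum (fun i _ => ?_) ⟨j, Finset.mem_univ j, ?_⟩))
    · simp only [PiLp.sub_apply, PiLp.smul_apply, smul_eq_mul, Real.norm_eq_abs, sq_abs]
      have h1 := hεi i
      rcases hsgn i with ⟨h2, h3⟩ | ⟨h2, h3⟩
      · rw [abs_of_nonneg h2, abs_of_nonneg h3] at h1
        nlinarith [mul_nonneg hεp.le h3]
      · rw [abs_of_nonpos h2, abs_of_nonpos h3] at h1
        nlinarith [mul_nonneg hεp.le (neg_nonneg.2 h3)]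
    · simp only [PiLp.sub_apply, PiLp.smul_apply, smul_eq_mul, Real.norm_eq_abs, sq_abs]
      have h1 := hεi j
      rcases hsgn j with ⟨h2, h3⟩ | ⟨h2, h3⟩
      · rw [abs_of_nonneg h2, abs_of_nonneg h3] at h1
        have := mul_pos hεp (lt_of_le_of_ne h3 hj.symm)
        nlinarith
      · rw [abs_of_nonpos h2, abs_of_nonpos h3] at h1
        have := mul_pos hεp (neg_pos.2 (lt_of_le_of_ne h3 hj))
        nlinarith
  have h1 := hcw _ hinj w (mem_signCone_sign w)
  have h2 : B w = B v - B u := by rw [hw, map_sub, hxs.2]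
  rw [h2] at h1
  refine h1.trans (mul_le_mul_of_nonneg_right ?_ (norm_nonneg _))
  exact Finset.single_le_sum (f := c) (fun σ _ => hc σ) (Finset.mem_univ _)

/-- A finitely generated cone is closed. -/
theorem isClosed_image_nonneg (B : EuclideanSpace ℝ ι →ₗ[ℝ] G) :
    IsClosed (B '' {u | ∀ i, 0 ≤ u i}) := by
  obtain ⟨c, hc, hB⟩ := exists_hoffman_constant B Set.univ
  have hBc : Continuous B := B.continuous_of_finiteDimensional
  have hN : IsClosed {u : EuclideanSpace ℝ ι | ∀ i, 0 ≤ u i} := by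
    have : {u : EuclideanSpace ℝ ι | ∀ i, 0 ≤ u i} = ⋂ i, {u | 0 ≤ u i} := by ext; simp
    rw [this]
    exact isClosed_iInter fun i => isClosed_le continuous_const (by fun_prop)
  refine isClosed_of_closure_subset fun d hd => ?_
  -- Hoffman's bound with u = 0 gives preimages of controlled norm, so near d the cone is contained
  -- in the image of a compact set.
  have hK : IsCompact (B '' (Metric.closedBall 0 (c * (‖d‖ + 1)) ∩ {u | ∀ i, 0 ≤ u i})) :=
    ((isCompact_closedBall _ _).inter_right hN).image hBc
  have hsub : (Metric.ball d 1 ∩ B '' {u | ∀ i, 0 ≤ u i}) ⊆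
      B '' (Metric.closedBall 0 (c * (‖d‖ + 1)) ∩ {u | ∀ i, 0 ≤ u i}) := by
    rintro _ ⟨hball, v, hv, rfl⟩
    obtain ⟨v', hv', hBv', hn⟩ := hB 0 v (by simp) (fun i _ => hv i)
    refine ⟨v', ⟨?_, fun i => hv' i trivial⟩, hBv'⟩
    rw [mem_closedBall_zero_iff]
    simp only [sub_zero, map_zero] at hn
    refine hn.trans (mul_le_mul_of_nonneg_left ?_ hc)
    rw [mem_ball_iff_norm] at hball
    have := norm_sub_norm_le (B v) d
    linarith
  have hd' : d ∈ closure (Metric.ball d 1 ∩ B '' {u | ∀ i, 0 ≤ u i}) := by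
    rw [mem_closure_iff_nhds] at hd ⊢
    intro t ht
    have := hd _ (Filter.inter_mem ht (Metric.ball_mem_nhds d one_pos))
    rwa [Set.inter_assoc] at this
  obtain ⟨u, hu, rfl⟩ := closure_minimal hsub hK.isClosed hd'
  exact ⟨u, hu.2, rfl⟩

end Hoffman

/-- Farkas' lemma: the polar of a polyhedral cone is generated by the normals of its facets. -/
theorem exists_nonneg_sum_of_mem_polarCone {E : Type*} [NormedAddCommGroup E]
    [InnerProductSpace ℝ E] [CompleteSpace E] (s : Finset E) {u : E}
    (hu : u ∈ polarCone {x : E | ∀ a ∈ s, ⟪a, x⟫ ≤ 0}) :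
    ∃ l : s → ℝ, (∀ a, 0 ≤ l a) ∧ ∑ a, l a • (a : E) = u := by
  let B : EuclideanSpace ℝ s →ₗ[ℝ] E :=
    (Fintype.linearCombination ℝ (fun a : s => (a : E))).comp
      (WithLp.linearEquiv 2 ℝ (s → ℝ)).toLinearMap
  have hB : ∀ x, B x = ∑ a, x a • (a : E) := fun x => by
    simp [B, Fintype.linearCombination_apply]
  set D : Set E := B '' {u | ∀ i, 0 ≤ u i} with hD
  have hDc : IsClosed D := isClosed_image_nonneg B
  by_cases hmem : u ∈ D
  · obtain ⟨x, hx, rfl⟩ := hmem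
    exact ⟨fun a => x a, hx, (hB x).symm⟩
  exfalso
  let C : ProperCone ℝ E :=
    { carrier := D
      add_mem' := by
        rintro _ _ ⟨x, hx, rfl⟩ ⟨y, hy, rfl⟩
        exact ⟨x + y, fun i => add_nonneg (hx i) (hy i), map_add _ _ _⟩
      zero_mem' := ⟨0, by simp, map_zero _⟩
      smul_mem' := by
        rintro t _ ⟨x, hx, rfl⟩
        refine ⟨(t : ℝ) • x, fun i => ?_, by rw [map_smul]; rfl⟩
        exact mul_nonneg t.2 (hx i)
      isClosed' := hDc }
  -- If u were outside the generated cone, a separating y would be nonnegative on the generators;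
  -- then -y lies in the polyhedral cone and contradicts the polarity of u.
  obtain ⟨y, hy, hyu⟩ := C.hyperplane_separation' (x₀ := u) hmem
  have hgen : ∀ a ∈ s, 0 ≤ ⟪a, y⟫ := by
    classical
    intro a ha
    refine hy a ⟨EuclideanSpace.single ⟨a, ha⟩ 1, fun i => ?_, ?_⟩
    · rw [PiLp.single_apply]
      split_ifs <;> simp
    · simp [hB]
  have := hu (-y) fun a ha => by rw [inner_neg_right]; linarith [hgen a ha]
  rw [inner_neg_right] at this
  linarith

/-! ### Positive semidefinite matrices: traces, kernels, strict complementarity. -/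

section PosSemidef

open Matrix

variable {m : Type*} [Fintype m]

theorem posSemidef_mul_mul_transpose {X : Matrix m m ℝ} (hX : X.PosSemidef) (B : Matrix m m ℝ) :
    (B * X * Bᵀ).PosSemidef := by
  simpa [conjTranspose_eq_transpose_of_trivial] using hX.mul_mul_conjTranspose_same B

theorem posSemidef_iff_dotProduct {X : Matrix m m ℝ} :
    X.PosSemidef ↔ Xᵀ = X ∧ ∀ x : m → ℝ, 0 ≤ x ⬝ᵥ X *ᵥ x := by
  rw [posSemidef_iff_dotProduct_mulVec, IsHermitian, conjTranspose_eq_transpose_of_trivial]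
  simp

/-- Submultiplicativity of the Frobenius norm, squared: Cauchy–Schwarz in each entry of the product.
-/
theorem trace_transpose_mul_self_mul_le (M N : Matrix m m ℝ) :
    ((M * N)ᵀ * (M * N)).trace ≤ (Mᵀ * M).trace * (Nᵀ * N).trace := by
  have hM : (Mᵀ * M).trace = ∑ i, ∑ k, M i k ^ 2 := by
    rw [Finset.sum_comm]
    simp [trace, mul_apply, sq]
  have hN : (Nᵀ * N).trace = ∑ j, ∑ k, N k j ^ 2 := by simp [trace, mul_apply, sq]
  have hMN : ((M * N)ᵀ * (M * N)).trace = ∑ j, ∑ i, (∑ k, M i k * N k j) ^ 2 := by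
    simp only [trace, diag_apply, mul_apply, transpose_apply, sq]
  rw [hM, hN, hMN, mul_comm, Finset.sum_mul]
  refine Finset.sum_le_sum fun j _ => ?_
  rw [Finset.mul_sum]
  refine Finset.sum_le_sum fun i _ => ?_
  rw [mul_comm]
  exact Finset.sum_mul_sq_le_sq_mul_sq _ _ _

/-- A matrix of corank at most one has its kernel inside a line. -/
theorem exists_ker_subset_span_singleton {S : Matrix m m ℝ}
    (h : Fintype.card m ≤ S.rank + 1) : ∃ v : m → ℝ, ∀ x, S *ᵥ x = 0 → ∃ c : ℝ, c • v = x := by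
  have h1 := S.mulVecLin.finrank_range_add_finrank_ker
  rw [Module.finrank_fintype_fun_eq_card] at h1
  have h2 : S.rank = Module.finrank ℝ (LinearMap.range S.mulVecLin) := rfl
  obtain ⟨v, hv⟩ := finrank_le_one_iff.1
    (show Module.finrank ℝ (LinearMap.ker S.mulVecLin) ≤ 1 by omega)
  refine ⟨v, fun x hx => ?_⟩
  obtain ⟨c, hc⟩ := hv ⟨x, by simpa using hx⟩
  exact ⟨c, congrArg Subtype.val hc⟩

variable [DecidableEq m]

theorem exists_orthogonal_diagonalization {S : Matrix m m ℝ} (hS : S.PosSemidef) :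
    ∃ (U : Matrix m m ℝ) (d : m → ℝ), U * Uᵀ = 1 ∧ Uᵀ * U = 1 ∧ (∀ i, 0 ≤ d i) ∧
      S = U * diagonal d * Uᵀ := by
  have hst : ∀ M : Matrix m m ℝ, star M = Mᵀ := fun M => by
    rw [star_eq_conjTranspose, conjTranspose_eq_transpose_of_trivial]
  refine ⟨hS.1.eigenvectorUnitary, hS.1.eigenvalues, ?_, ?_, hS.eigenvalues_nonneg, ?_⟩
  · rw [← hst]; exact Unitary.coe_mul_star_self _
  · rw [← hst]; exact Unitary.coe_star_mul_self _
  · rw [← hst]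
    exact hS.1.spectral_theorem

theorem exists_eq_transpose_mul_self {S : Matrix m m ℝ} (hS : S.PosSemidef) :
    ∃ B : Matrix m m ℝ, S = Bᵀ * B := by
  obtain ⟨U, d, -, -, hd, rfl⟩ := exists_orthogonal_diagonalization hS
  refine ⟨diagonal (fun i => √(d i)) * Uᵀ, ?_⟩
  have : diagonal d = diagonal (fun i => √(d i)) * diagonal (fun i => √(d i)) := by
    rw [diagonal_mul_diagonal]
    congr 1
    ext i
    rw [Real.mul_self_sqrt (hd i)]
  rw [this, transpose_mul, transpose_transpose, diagonal_transpose]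
  simp only [Matrix.mul_assoc]

theorem trace_mul_nonneg {X Z : Matrix m m ℝ} (hX : X.PosSemidef) (hZ : Z.PosSemidef) :
    0 ≤ (X * Z).trace := by
  obtain ⟨B, rfl⟩ := exists_eq_transpose_mul_self hZ
  rw [← Matrix.mul_assoc, trace_mul_comm, ← Matrix.mul_assoc]
  exact (posSemidef_mul_mul_transpose hX B).trace_nonneg

/-- For X = BᵀB and Z = DᵀD the trace is the squared Frobenius norm of D Bᵀ. -/
theorem mul_eq_zero_of_trace_mul_eq_zero {X Z : Matrix m m ℝ} (hX : X.PosSemidef)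
    (hZ : Z.PosSemidef) (h : (X * Z).trace = 0) : X * Z = 0 := by
  obtain ⟨B, rfl⟩ := exists_eq_transpose_mul_self hX
  obtain ⟨D, rfl⟩ := exists_eq_transpose_mul_self hZ
  have h1 : ((D * Bᵀ)ᴴ * (D * Bᵀ)).trace = 0 := by
    rw [conjTranspose_eq_transpose_of_trivial, transpose_mul, transpose_transpose, ← h,
      Matrix.mul_assoc, trace_mul_comm B, trace_mul_comm (Bᵀ * B)]
    simp only [Matrix.mul_assoc]
  have h2 : D * Bᵀ = 0 := trace_conjTranspose_mul_self_eq_zero_iff.1 h1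
  have h3 : B * Dᵀ = 0 := by
    rw [← transpose_transpose B, ← transpose_mul, h2, transpose_zero]
  rw [Matrix.mul_assoc, ← Matrix.mul_assoc B, h3, Matrix.zero_mul, Matrix.mul_zero]

/-- The orthogonal projection `p` onto the kernel of a positive semidefinite matrix `S`; on the
complement, `S` is bounded below. -/
theorem exists_kernel_projection {S : Matrix m m ℝ} (hS : S.PosSemidef) :
    ∃ (p : Matrix m m ℝ) (r : ℝ), 0 < r ∧ pᵀ = p ∧ p * p = p ∧ S * p = 0 ∧
      (S - r • (1 - p)).PosSemidef := by
  obtain ⟨U, d, hU, hU', hd, rfl⟩ := exists_orthogonal_diagonalization hS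
  -- r bounds the nonzero eigenvalues from below; p is the spectral projection for the eigenvalue 0.
  obtain ⟨r, hr, hrd⟩ : ∃ r : ℝ, 0 < r ∧ ∀ i, d i ≠ 0 → r ≤ d i := by
    have : ∀ i, ∃ r : ℝ, 0 < r ∧ (d i ≠ 0 → r ≤ d i) := fun i => by
      by_cases h : d i = 0
      · exact ⟨1, one_pos, fun h' => (h' h).elim⟩
      · exact ⟨d i, lt_of_le_of_ne (hd i) (Ne.symm h), fun _ => le_rfl⟩
    choose r hr hrd using this
    by_cases hm : Nonempty m
    · refine ⟨Finset.univ.inf' Finset.univ_nonempty r, ?_, fun i hi => ?_⟩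
      · rw [Finset.lt_inf'_iff]; exact fun i _ => hr i
      · exact (Finset.inf'_le _ (Finset.mem_univ i)).trans (hrd i hi)
    · exact ⟨1, one_pos, fun i => (hm ⟨i⟩).elim⟩
  set e : m → ℝ := fun i => if d i = 0 then 1 else 0 with he
  have hmul : ∀ a b : m → ℝ, U * diagonal a * Uᵀ * (U * diagonal b * Uᵀ) =
      U * diagonal (fun i => a i * b i) * Uᵀ := fun a b => by
    rw [← diagonal_mul_diagonal]
    calc U * diagonal a * Uᵀ * (U * diagonal b * Uᵀ)
        = U * diagonal a * (Uᵀ * U) * diagonal b * Uᵀ := by simp only [Matrix.mul_assoc]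
      _ = _ := by rw [hU', Matrix.mul_one]; simp only [Matrix.mul_assoc]
  have hone : (1 : Matrix m m ℝ) = U * diagonal (fun _ => (1 : ℝ)) * Uᵀ := by
    rw [diagonal_one, Matrix.mul_one, hU]
  have hsub : ∀ a b : m → ℝ, U * diagonal a * Uᵀ - U * diagonal b * Uᵀ =
      U * diagonal (fun i => a i - b i) * Uᵀ := fun a b => by
    rw [← diagonal_sub, Matrix.mul_sub, Matrix.sub_mul]
  refine ⟨U * diagonal e * Uᵀ, r, hr, ?_, ?_, ?_, ?_⟩
  · simp only [transpose_mul, transpose_transpose, diagonal_transpose, Matrix.mul_assoc]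
  · rw [hmul]
    congr 3
    ext i
    simp only [he]
    split_ifs <;> simp
  · rw [hmul]
    have : (fun i => d i * e i) = 0 := by
      ext i
      simp only [he, Pi.zero_apply]
      split_ifs with h <;> simp [h]
    rw [this]
    simp
  · have : U * diagonal d * Uᵀ - r • (1 - U * diagonal e * Uᵀ) =
        U * diagonal (fun i => d i - r * (1 - e i)) * Uᵀ := by
      rw [hone, hsub, ← hsub d fun i => r * (1 - e i), ← Matrix.smul_mul, ← Matrix.mul_smul,
        ← diagonal_smul]
      rfl
    rw [this]
    refine posSemidef_mul_mul_transpose (PosSemidef.diagonal fun i => ?_) U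
    simp only [he, Pi.zero_apply]
    split_ifs with h
    · simp [h]
    · linarith [hrd i h]

/-- Strictly complementary positive semidefinite matrices have a positive definite sum. -/
theorem exists_smul_le_add_of_rank_add_rank {X S : Matrix m m ℝ} (hX : X.PosSemidef)
    (hS : S.PosSemidef) (h : X * S = 0) (hrank : X.rank + S.rank = Fintype.card m) :
    ∃ ε : ℝ, 0 < ε ∧ (X + S - ε • (1 : Matrix m m ℝ)).PosSemidef := by
  have hker : ∀ x, (X + S) *ᵥ x = 0 → x = 0 := by
    intro x hx
    have hXx := hX.dotProduct_mulVec_nonneg x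
    have hSx := hS.dotProduct_mulVec_nonneg x
    have hsum : star x ⬝ᵥ X *ᵥ x + star x ⬝ᵥ S *ᵥ x = 0 := by
      rw [← dotProduct_add, ← add_mulVec, hx, dotProduct_zero]
    have hX0 : X *ᵥ x = 0 := (hX.dotProduct_mulVec_zero_iff x).1 (by linarith)
    have hS0 : S *ᵥ x = 0 := (hS.dotProduct_mulVec_zero_iff x).1 (by linarith)
    -- The rank condition turns range S ⊆ ker X into an equality. Hence x ∈ ker X has the form S z,
    -- and S x = 0 makes x orthogonal to itself.
    have hle : LinearMap.range S.mulVecLin ≤ LinearMap.ker X.mulVecLin := by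
      rintro _ ⟨z, rfl⟩
      simp [h]
    have hfr : Module.finrank ℝ (LinearMap.range S.mulVecLin) =
        Module.finrank ℝ (LinearMap.ker X.mulVecLin) := by
      have h1 := X.mulVecLin.finrank_range_add_finrank_ker
      rw [Module.finrank_fintype_fun_eq_card] at h1
      have h2 : X.rank = Module.finrank ℝ (LinearMap.range X.mulVecLin) := rfl
      have h3 : S.rank = Module.finrank ℝ (LinearMap.range S.mulVecLin) := rfl
      omega
    have heq := Submodule.eq_of_le_of_finrank_eq hle hfr
    have hmem : x ∈ LinearMap.range S.mulVecLin := by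
      rw [heq]
      simpa using hX0
    obtain ⟨z, hz⟩ := hmem
    rw [mulVecLin_apply] at hz
    have hSt : Sᵀ = S := (posSemidef_iff_dotProduct.1 hS).1
    have : x ⬝ᵥ x = 0 := by
      nth_rewrite 2 [← hz]
      rw [dotProduct_mulVec, ← mulVec_transpose, hSt, hS0, zero_dotProduct]
    exact dotProduct_self_eq_zero.1 this
  obtain ⟨p, r, hr, -, -, hp, hle⟩ := exists_kernel_projection (hX.add hS)
  have hp0 : p = 0 := by
    refine ext_of_mulVec_single fun i => ?_
    rw [zero_mulVec]
    exact hker _ (by rw [mulVec_mulVec, hp, zero_mulVec])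
  rw [hp0, sub_zero] at hle
  exact ⟨r, hr, hle⟩

end PosSemidef

/-! ### Geometry of the faces of the semidefinite cone. -/

section SymMat

open Matrix

variable {n : ℕ}

@[simp] theorem SymMat.toMatrix_add (X Z : SymMat n) :
    (X + Z).toMatrix = X.toMatrix + Z.toMatrix := rfl

@[simp] theorem SymMat.toMatrix_sub (X Z : SymMat n) :
    (X - Z).toMatrix = X.toMatrix - Z.toMatrix := rfl

@[simp] theorem SymMat.toMatrix_smul (t : ℝ) (X : SymMat n) :
    (t • X).toMatrix = t • X.toMatrix := rfl

@[simp] theorem SymMat.toMatrix_neg (X : SymMat n) : (-X).toMatrix = -X.toMatrix := rfl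

@[simp] theorem SymMat.toMatrix_zero : (0 : SymMat n).toMatrix = 0 := rfl

@[simp] theorem SymMat.transpose_toMatrix (X : SymMat n) : X.toMatrixᵀ = X.toMatrix := by
  ext i j
  exact X.2 j i

theorem SymMat.toMatrix_injective : Function.Injective (SymMat.toMatrix (n := n)) := by
  intro X Z h
  refine Subtype.ext (PiLp.ext fun ij => ?_)
  exact congrFun (congrFun h ij.1) ij.2

/-- The element of `𝕊ⁿ` with the given symmetric matrix. -/
def SymMat.ofMatrix (M : Matrix (Fin n) (Fin n) ℝ) (hM : Mᵀ = M) : SymMat n :=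
  ⟨WithLp.toLp 2 fun ij => M ij.1 ij.2, fun i j => congrFun (congrFun hM j) i⟩

@[simp] theorem SymMat.toMatrix_ofMatrix (M : Matrix (Fin n) (Fin n) ℝ) (hM : Mᵀ = M) :
    (SymMat.ofMatrix M hM).toMatrix = M := rfl

/-- The linear map `X ↦ G X Gᵀ`. -/
def SymMat.conj (G : Matrix (Fin n) (Fin n) ℝ) : SymMat n →ₗ[ℝ] SymMat n where
  toFun X := SymMat.ofMatrix (G * X.toMatrix * Gᵀ) (by
    simp only [transpose_mul, transpose_transpose, SymMat.transpose_toMatrix, Matrix.mul_assoc])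
  map_add' X Z := SymMat.toMatrix_injective (by simp [Matrix.mul_add, Matrix.add_mul])
  map_smul' t X := SymMat.toMatrix_injective (by simp)

@[simp] theorem SymMat.toMatrix_conj (G : Matrix (Fin n) (Fin n) ℝ) (X : SymMat n) :
    (SymMat.conj G X).toMatrix = G * X.toMatrix * Gᵀ := rfl

theorem SymMat.inner_eq (X Z : SymMat n) : ⟪X, Z⟫ = (X.toMatrix * Z.toMatrix).trace := by
  rw [SymMat.inner_eq_trace, SymMat.transpose_toMatrix]

theorem SymMat.inner_smul_left (t : ℝ) (X Z : SymMat n) : ⟪t • X, Z⟫ = t * ⟪X, Z⟫ :=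
  real_inner_smul_left X Z t

theorem SymMat.inner_smul_right (t : ℝ) (X Z : SymMat n) : ⟪X, t • Z⟫ = t * ⟪X, Z⟫ :=
  real_inner_smul_right X Z t

theorem SymMat.norm_sq_eq (X : SymMat n) : ‖X‖ ^ 2 = (X.toMatrix * X.toMatrix).trace := by
  rw [← SymMat.inner_eq, real_inner_self_eq_norm_sq]

/-- Cauchy–Schwarz for the pairing of X with x xᵀ, whose Frobenius norm is x ⬝ x. -/
theorem SymMat.abs_dotProduct_mulVec_le (X : SymMat n) (x : Fin n → ℝ) :
    |x ⬝ᵥ X.toMatrix *ᵥ x| ≤ ‖X‖ * (x ⬝ᵥ x) := by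
  have h0 : 0 ≤ x ⬝ᵥ x := dotProduct_self_star_nonneg x
  refine abs_le_of_sq_le_sq ?_ (by positivity)
  have h1 : x ⬝ᵥ X.toMatrix *ᵥ x =
      ∑ ij : Fin n × Fin n, X.toMatrix ij.1 ij.2 * (x ij.1 * x ij.2) := by
    simp only [dotProduct, mulVec, Fintype.sum_prod_type, Finset.mul_sum]
    exact Finset.sum_congr rfl fun i _ => Finset.sum_congr rfl fun j _ => by ring
  have h2 : ‖X‖ ^ 2 = ∑ ij : Fin n × Fin n, X.toMatrix ij.1 ij.2 ^ 2 := by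
    have : ‖X‖ = ‖X.1‖ := rfl
    rw [this, EuclideanSpace.norm_sq_eq]
    simp [SymMat.toMatrix]
  have h3 : (x ⬝ᵥ x) ^ 2 = ∑ ij : Fin n × Fin n, (x ij.1 * x ij.2) ^ 2 := by
    simp only [dotProduct, sq, Fintype.sum_prod_type, Finset.sum_mul_sum]
    exact Finset.sum_congr rfl fun i _ => Finset.sum_congr rfl fun j _ => by ring
  rw [mul_pow, h1, h2, h3]
  exact Finset.sum_mul_sq_le_sq_mul_sq _ _ _

theorem mem_psdCone_iff {X : SymMat n} :
    X ∈ psdCone n ↔ ∀ x : Fin n → ℝ, 0 ≤ x ⬝ᵥ X.toMatrix *ᵥ x := by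
  simp [psdCone, posSemidef_iff_dotProduct]

theorem inner_nonneg_of_mem_psdCone {X Z : SymMat n} (hX : X ∈ psdCone n) (hZ : Z ∈ psdCone n) :
    0 ≤ ⟪X, Z⟫ := by
  rw [SymMat.inner_eq]
  exact trace_mul_nonneg hX hZ

theorem zero_mem_psdCone : (0 : SymMat n) ∈ psdCone n := PosSemidef.zero

theorem smul_mem_psdCone {X : SymMat n} (hX : X ∈ psdCone n) {t : ℝ} (ht : 0 ≤ t) :
    t • X ∈ psdCone n := PosSemidef.smul hX ht

theorem add_mem_psdCone {X Z : SymMat n} (hX : X ∈ psdCone n) (hZ : Z ∈ psdCone n) :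
    X + Z ∈ psdCone n := PosSemidef.add hX hZ

theorem conj_mem_psdCone (G : Matrix (Fin n) (Fin n) ℝ) {X : SymMat n} (hX : X ∈ psdCone n) :
    SymMat.conj G X ∈ psdCone n := posSemidef_mul_mul_transpose hX G

/-- The cone of positive semidefinite matrices is self-dual. -/
theorem exists_mem_psdCone_inner_neg {X : SymMat n} (hX : X ∉ psdCone n) :
    ∃ S ∈ psdCone n, ⟪X, S⟫ < 0 := by
  rw [mem_psdCone_iff] at hX
  push Not at hX
  obtain ⟨x, hx⟩ := hX
  have hps : (vecMulVec x x).PosSemidef := by simpa using posSemidef_vecMulVec_self_star x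
  refine ⟨SymMat.ofMatrix (vecMulVec x x) (transpose_vecMulVec x x), hps, ?_⟩
  rw [SymMat.inner_eq, SymMat.toMatrix_ofMatrix, mul_vecMulVec, trace_vecMulVec, dotProduct_comm]
  exact hx

variable {S p : Matrix (Fin n) (Fin n) ℝ} {r : ℝ}

theorem dotProduct_conj_mulVec (hpt : pᵀ = p) (X : SymMat n) (x : Fin n → ℝ) :
    x ⬝ᵥ (SymMat.conj p X).toMatrix *ᵥ x = (p *ᵥ x) ⬝ᵥ X.toMatrix *ᵥ (p *ᵥ x) := by
  rw [SymMat.toMatrix_conj, ← mulVec_mulVec, ← mulVec_mulVec, hpt, dotProduct_mulVec,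
    ← mulVec_transpose, hpt]

/-- On bounded sets of positive semidefinite matrices, the squared distance to the face
`{X | ⟨S, X⟩ = 0}` is controlled by `⟨S, X⟩`. -/
theorem norm_sub_conj_sq_le (hr : 0 < r) (hpt : pᵀ = p) (hpp : p * p = p)
    (hle : (S - r • (1 - p)).PosSemidef) {X : SymMat n} (hX : X ∈ psdCone n) :
    r * ‖X - SymMat.conj p X‖ ^ 2 ≤ 2 * X.toMatrix.trace * (S * X.toMatrix).trace := by
  set M := X.toMatrix with hM
  have hMt : Mᵀ = M := X.transpose_toMatrix
  obtain ⟨B, hB⟩ := exists_eq_transpose_mul_self hX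
  rw [← hM] at hB
  set q := 1 - p with hq
  have hqt : qᵀ = q := by simp [hq, hpt]
  have hqq : q * q = q := by rw [hq, Matrix.mul_sub, Matrix.sub_mul, Matrix.sub_mul, hpp]; simp
  have hp : p = 1 - q := by simp [hq]
  have htr : 0 ≤ M.trace := hX.trace_nonneg
  -- The last trace is nonnegative and will be dropped, which leaves only 2 tr(q M M) = 2‖q M‖² to
  -- estimate.
  have h1 : ‖X - SymMat.conj p X‖ ^ 2 = 2 * (q * M * M).trace - (q * M * q * M).trace := by
    rw [SymMat.norm_sq_eq, SymMat.toMatrix_sub, SymMat.toMatrix_conj, hpt, ← hM]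
    have e1 : (M * (p * M * p)).trace = (p * M * p * M).trace := trace_mul_comm _ _
    have e2 : (p * M * p * (p * M * p)).trace = (p * M * p * M).trace := by
      calc (p * M * p * (p * M * p)).trace = (p * M * (p * p) * M * p).trace := by
            simp only [Matrix.mul_assoc]
        _ = (p * (p * M * p * M)).trace := by rw [hpp, trace_mul_comm]
        _ = (p * p * M * p * M).trace := by simp only [Matrix.mul_assoc]
        _ = _ := by rw [hpp]
    have e3 : (p * M * p * M).trace = (M * M).trace - 2 * (q * M * M).trace
        + (q * M * q * M).trace := by
      have e4 : (M * q * M).trace = (q * M * M).trace := by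
        rw [Matrix.mul_assoc, trace_mul_comm]
      rw [hp]
      simp only [Matrix.sub_mul, Matrix.mul_sub, Matrix.one_mul, Matrix.mul_one, trace_sub, e4]
      ring
    rw [Matrix.sub_mul, Matrix.mul_sub, Matrix.mul_sub, trace_sub, trace_sub, trace_sub, e1, e2, e3]
    ring
  have h2 : 0 ≤ (q * M * q * M).trace := by
    have := trace_mul_nonneg (posSemidef_mul_mul_transpose hX q) hX
    rwa [hqt] at this
  -- Factor q M = (q Bᵀ) B: the squared Frobenius norms of the factors are tr(q M) and tr M.
  have h3 : (q * M * M).trace ≤ (q * M).trace * M.trace := by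
    have h4 := trace_transpose_mul_self_mul_le (q * Bᵀ) B
    have e1 : ((q * Bᵀ * B)ᵀ * (q * Bᵀ * B)).trace = (q * M * M).trace := by
      rw [Matrix.mul_assoc q, ← hB, transpose_mul, hMt, hqt, trace_mul_comm, Matrix.mul_assoc q M,
        ← Matrix.mul_assoc M, trace_mul_comm q, Matrix.mul_assoc, hqq, trace_mul_comm,
        Matrix.mul_assoc]
    have e2 : ((q * Bᵀ)ᵀ * (q * Bᵀ)).trace = (q * M).trace := by
      rw [trace_mul_comm, transpose_mul, transpose_transpose, hqt, ← Matrix.mul_assoc,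
        trace_mul_comm, hB, ← Matrix.mul_assoc, ← Matrix.mul_assoc, hqq,
        Matrix.mul_assoc]
    rwa [e1, e2, ← hB] at h4
  have h5 : r * (q * M).trace ≤ (S * M).trace := by
    have := trace_mul_nonneg hle hX
    rw [Matrix.sub_mul, trace_sub, Matrix.smul_mul, trace_smul, smul_eq_mul] at this
    linarith
  rw [h1]
  nlinarith [mul_le_mul_of_nonneg_right h5 htr, mul_nonneg hr.le h2,
    mul_le_mul_of_nonneg_left h3 hr.le]

/-- Under strict complementarity the face exposed by `S` contains a relative neighbourhood of
`Xb`. -/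
theorem exists_mem_psdCone_of_norm_sub_le (hpt : pᵀ = p) (hSp : S * p = 0) (hS : S.PosSemidef)
    {Xb : SymMat n} (hXb : Xb ∈ psdCone n) (hcompl : (S * Xb.toMatrix).trace = 0)
    (hrank : Xb.toMatrix.rank + S.rank = n) :
    ∃ ε : ℝ, 0 < ε ∧ ∀ Z, SymMat.conj p Z = Z → ‖Z - Xb‖ ≤ ε → Z ∈ psdCone n := by
  rw [trace_mul_comm] at hcompl
  obtain ⟨ε, hε, hpos⟩ := exists_smul_le_add_of_rank_add_rank hXb hS
    (mul_eq_zero_of_trace_mul_eq_zero hXb hS hcompl) (by simpa using hrank)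
  refine ⟨ε, hε, fun Z hZ hZX => mem_psdCone_iff.2 fun x => ?_⟩
  rw [← hZ, dotProduct_conj_mulVec hpt]
  set x' := p *ᵥ x with hx'
  have hSx : S *ᵥ x' = 0 := by rw [hx', mulVec_mulVec, hSp, zero_mulVec]
  -- On ker S the bound X + S ≥ ε concerns Xb alone, so a perturbation of norm at most ε keeps the
  -- form nonnegative there.
  have h1 := (posSemidef_iff_dotProduct.1 hpos).2 x'
  rw [sub_mulVec, add_mulVec, hSx, add_zero, smul_mulVec, one_mulVec, dotProduct_sub,
    dotProduct_smul, smul_eq_mul] at h1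
  have h2 := (abs_le.1 ((Z - Xb).abs_dotProduct_mulVec_le x')).1
  rw [SymMat.toMatrix_sub, sub_mulVec, dotProduct_sub] at h2
  have h3 : 0 ≤ x' ⬝ᵥ x' := dotProduct_self_star_nonneg x'
  nlinarith [mul_le_mul_of_nonneg_right hZX h3]

/-- Every matrix in the span of the face exposed by `S` can be moved towards `Xb` into the face
itself, without increasing too much the distance to points of the face. -/
def FaceRegular (p : Matrix (Fin n) (Fin n) ℝ) (Xb : SymMat n) : Prop :=
  ∃ c : ℝ, 0 ≤ c ∧ ∀ X ∈ psdCone n, ∀ Z, SymMat.conj p X = X → SymMat.conj p Z = Z →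
    ∃ t : ℝ, 0 ≤ t ∧ t ≤ 1 ∧ (1 - t) • Z + t • Xb ∈ psdCone n ∧
      ‖(1 - t) • Z + t • Xb - X‖ ≤ c * (1 + ‖Xb - Z‖) * ‖Z - X‖

/-- Xb is positive definite on ker S, so a ball around it in the span of the face is semidefinite. A
step towards Xb of size proportional to ‖Z - X‖ is then enough. -/
theorem faceRegular_of_rank_add_rank (hpt : pᵀ = p) (hSp : S * p = 0) (hS : S.PosSemidef)
    {Xb : SymMat n} (hXb : Xb ∈ psdCone n) (hpXb : SymMat.conj p Xb = Xb)
    (hcompl : (S * Xb.toMatrix).trace = 0) (hrank : Xb.toMatrix.rank + S.rank = n) :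
    FaceRegular p Xb := by
  obtain ⟨ε, hε, hball⟩ := exists_mem_psdCone_of_norm_sub_le hpt hSp hS hXb hcompl hrank
  refine ⟨1 + ε⁻¹, by positivity, fun X hX Z hpX hpZ => ?_⟩
  set δ := ‖Z - X‖ with hδ
  have hδ0 : 0 ≤ δ := norm_nonneg _
  rcases hδ0.eq_or_lt with h0 | hδpos
  · have hZX : Z = X := sub_eq_zero.1 (norm_eq_zero.1 h0.symm)
    refine ⟨0, le_rfl, zero_le_one, by simpa [hZX] using hX, ?_⟩
    simp [hZX]
    positivity
  have hsum : 0 < δ + ε := by positivity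
  -- For this t the combination is also a convex combination of X and Xb + (ε/δ)(Z - X), and the
  -- latter is at distance ε from Xb.
  refine ⟨δ / (δ + ε), by positivity, (div_le_one hsum).2 (by linarith), ?_, ?_⟩
  · have hmem : Xb + (ε / δ) • (Z - X) ∈ psdCone n := by
      refine hball _ (by simp [hpXb, hpX, hpZ]) ?_
      rw [add_sub_cancel_left, norm_smul, Real.norm_of_nonneg (by positivity), ← hδ]
      exact (div_mul_cancel₀ ε hδpos.ne').le
    have heq : (1 - δ / (δ + ε)) • Z + (δ / (δ + ε)) • Xb =
        (ε / (δ + ε)) • X + (δ / (δ + ε)) • (Xb + (ε / δ) • (Z - X)) := by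
      have h1 : 1 - δ / (δ + ε) = ε / (δ + ε) := by field_simp; ring
      have h2 : δ / (δ + ε) * (ε / δ) = ε / (δ + ε) := by field_simp
      rw [smul_add, smul_smul, h1, h2, smul_sub]
      abel
    rw [heq]
    exact add_mem_psdCone (smul_mem_psdCone hX (by positivity))
      (smul_mem_psdCone hmem (by positivity))
  · have heq : (1 - δ / (δ + ε)) • Z + (δ / (δ + ε)) • Xb - X =
        (Z - X) + (δ / (δ + ε)) • (Xb - Z) := by
      rw [sub_smul, one_smul, smul_sub]
      abel
    rw [heq]
    refine (norm_add_le _ _).trans ?_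
    rw [norm_smul, Real.norm_of_nonneg (by positivity), ← hδ]
    have h1 : δ / (δ + ε) ≤ ε⁻¹ * δ := by
      rw [inv_mul_eq_div]
      exact div_le_div_of_nonneg_left hδ0 hε (by linarith)
    have h2 := mul_le_mul_of_nonneg_right h1 (norm_nonneg (Xb - Z))
    have h3 : 0 ≤ ε⁻¹ * δ := by positivity
    have h4 : 0 ≤ ‖Xb - Z‖ * δ := by positivity
    nlinarith

/-- The span of the face has dimension at most one. If Z is not in the face, the segment from Z to
Xb passes through 0, which is no further from X than Z is. -/
theorem faceRegular_of_le_rank_add_one (hpt : pᵀ = p) (hSp : S * p = 0)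
    {Xb : SymMat n} (hXb : Xb ∈ psdCone n) (hpXb : SymMat.conj p Xb = Xb)
    (hrank : n ≤ S.rank + 1) : FaceRegular p Xb := by
  obtain ⟨v, hv⟩ := exists_ker_subset_span_singleton (S := S) (by simpa using hrank)
  have hquad : ∀ Z : SymMat n, SymMat.conj p Z = Z → ∀ x : Fin n → ℝ, ∃ c : ℝ,
      x ⬝ᵥ Z.toMatrix *ᵥ x = c ^ 2 * (v ⬝ᵥ Z.toMatrix *ᵥ v) := by
    intro Z hZ x
    obtain ⟨c, hc⟩ := hv (p *ᵥ x) (by rw [mulVec_mulVec, hSp, zero_mulVec])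
    refine ⟨c, ?_⟩
    conv_lhs => rw [← hZ]
    rw [dotProduct_conj_mulVec hpt, ← hc, mulVec_smul, smul_dotProduct, dotProduct_smul,
      smul_eq_mul, smul_eq_mul]
    ring
  have hpsd : ∀ Z : SymMat n, SymMat.conj p Z = Z → 0 ≤ v ⬝ᵥ Z.toMatrix *ᵥ v →
      Z ∈ psdCone n := by
    intro Z hZ h
    refine mem_psdCone_iff.2 fun x => ?_
    obtain ⟨c, hc⟩ := hquad Z hZ x
    rw [hc]
    positivity
  refine ⟨1, zero_le_one, fun X hX Z hpX hpZ => ?_⟩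
  have hle : ‖Z - X‖ ≤ 1 * (1 + ‖Xb - Z‖) * ‖Z - X‖ := by
    rw [one_mul, add_mul, one_mul]
    exact le_add_of_nonneg_right (by positivity)
  by_cases hZ : 0 ≤ v ⬝ᵥ Z.toMatrix *ᵥ v
  · refine ⟨0, le_rfl, zero_le_one, by simpa using hpsd Z hpZ hZ, by simpa using hle⟩
  push Not at hZ
  have hXbv : 0 ≤ v ⬝ᵥ Xb.toMatrix *ᵥ v := mem_psdCone_iff.1 hXb v
  set a := v ⬝ᵥ Xb.toMatrix *ᵥ v
  set b := v ⬝ᵥ Z.toMatrix *ᵥ v with hb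
  have hab : 0 < a - b := by linarith
  -- The form at v is affine along the segment and vanishes at this t; its value at v determines a
  -- matrix in the span of the face.
  set t := -b / (a - b) with ht
  have hzero : (1 - t) • Z + t • Xb = 0 := by
    have hp' : SymMat.conj p ((1 - t) • Z + t • Xb) = (1 - t) • Z + t • Xb := by
      simp [hpXb, hpZ]
    have hval : v ⬝ᵥ ((1 - t) • Z + t • Xb).toMatrix *ᵥ v = 0 := by
      rw [SymMat.toMatrix_add, SymMat.toMatrix_smul, SymMat.toMatrix_smul, add_mulVec,
        dotProduct_add, smul_mulVec, smul_mulVec, dotProduct_smul, dotProduct_smul, smul_eq_mul,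
        smul_eq_mul]
      change (1 - t) * b + t * a = 0
      rw [ht]
      field_simp
      ring
    have hpos := hpsd _ hp' hval.ge
    refine SymMat.toMatrix_injective (ext_of_mulVec_single fun i => ?_)
    rw [SymMat.toMatrix_zero, zero_mulVec]
    refine (PosSemidef.dotProduct_mulVec_zero_iff hpos _).1 ?_
    obtain ⟨c, hc⟩ := hquad _ hp' (Pi.single i 1)
    rw [star_trivial, hc, hval, mul_zero]
  refine ⟨t, div_nonneg (by linarith) hab.le, (div_le_one hab).2 (by linarith), ?_, ?_⟩
  · rw [hzero]; exact zero_mem_psdCone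
  · rw [hzero, zero_sub, norm_neg]
    refine le_trans ?_ hle
    -- With -Z semidefinite, ⟨Z, X⟩ ≤ 0, hence ‖X‖ ≤ ‖Z - X‖.
    have hneg : -Z ∈ psdCone n := by
      refine hpsd (-Z) (by simp [hpZ]) ?_
      rw [SymMat.toMatrix_neg, neg_mulVec, dotProduct_neg]
      linarith
    have h1 := inner_nonneg_of_mem_psdCone hneg hX
    rw [inner_neg_left] at h1
    refine abs_le_of_sq_le_sq' ?_ (norm_nonneg _) |>.2
    rw [norm_sub_sq_real]
    nlinarith [sq_nonneg ‖Z‖]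

end SymMat

namespace Problem

/-! ### The dual function and its relation to the objective. -/

section Duality

variable {n : ℕ} {Y W : Type*} [NormedAddCommGroup Y] [InnerProductSpace ℝ Y]
  [NormedAddCommGroup W] [InnerProductSpace ℝ W] {P : Problem n Y W}

/-- The real-valued objective, without the constraint `X ∈ 𝕊ⁿ₊`. -/
noncomputable def realObjective (P : Problem n Y W) (X : SymMat n) : ℝ :=
  (P.h (P.F X)).toReal + ⟪P.C, X⟫

theorem IsAdmissible.coe_toReal (hP : P.IsAdmissible) {w : W} (hw : w ∈ effDomain P.h) :
    ((P.h w).toReal : EReal) = P.h w :=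
  EReal.coe_toReal (ne_of_lt hw) (hP.ne_bot w)

theorem IsAdmissible.zero_mem (hP : P.IsAdmissible) : (0 : Y) ∈ P.Q := by
  obtain ⟨s, hs⟩ := hP.polyhedral
  simp [hs]

theorem IsAdmissible.smul_mem (hP : P.IsAdmissible) {y : Y} (hy : y ∈ P.Q) {t : ℝ} (ht : 0 ≤ t) :
    t • y ∈ P.Q := by
  obtain ⟨s, hs⟩ := hP.polyhedral
  rw [hs] at hy ⊢
  intro a ha
  rw [inner_smul_right]
  exact mul_nonpos_of_nonneg_of_nonpos ht (hy a ha)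

theorem IsAdmissible.objective_eq (hP : P.IsAdmissible) {X : SymMat n} (hX : X ∈ psdCone n)
    (hF : P.F X ∈ effDomain P.h) : P.objective X = (P.realObjective X : EReal) := by
  rw [objective, indicatorFn, if_pos hX, add_zero, realObjective, EReal.coe_add, hP.coe_toReal hF]

theorem IsAdmissible.mem_of_objective_lt_top (hP : P.IsAdmissible) {X : SymMat n}
    (h : P.objective X < ⊤) : X ∈ psdCone n ∧ P.F X ∈ effDomain P.h := by
  constructor
  · by_contra hX
    rw [objective, indicatorFn, if_neg hX, EReal.add_top_of_ne_bot] at h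
    · exact lt_irrefl _ h
    · exact EReal.add_ne_bot_iff.2 ⟨hP.ne_bot _, EReal.coe_ne_bot _⟩
  · by_contra hF
    have hF' : P.h (P.F X) = ⊤ := not_lt_top_iff.1 hF
    rw [objective, hF', EReal.top_add_coe, EReal.top_add_of_ne_bot] at h
    · exact lt_irrefl _ h
    · rw [indicatorFn]
      split_ifs <;> simp

/-- Differentiable convex functions lie above their tangents. -/
theorem IsAdmissible.add_fderiv_le (hP : P.IsAdmissible) (hgrowth : P.LocalGrowth) {w w' : W}
    (hw : w ∈ effDomain P.h) (hw' : w' ∈ effDomain P.h) :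
    (P.h w).toReal + fderiv ℝ (fun u => (P.h u).toReal) w (w' - w) ≤ (P.h w').toReal := by
  set D := fderiv ℝ (fun u => (P.h u).toReal) w with hD
  -- After subtracting the tangent, local growth makes w a local minimizer, and local minimizers of
  -- convex functions are global.
  have hconv : ConvexOn ℝ (effDomain P.h) (fun u => (P.h u).toReal - D (u - w)) := by
    refine ⟨hP.strictConvex.1, fun x hx z hz a b ha hb hab => ?_⟩
    have h1 := hP.strictConvex.convexOn.2 hx hz ha hb hab
    have h2 : D (a • x + b • z - w) = a * D (x - w) + b * D (z - w) := by
      have : a • x + b • z - w = a • (x - w) + b • (z - w) := by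
        rw [smul_sub, smul_sub, sub_add_sub_comm, ← add_smul, hab, one_smul]
      rw [this, map_add, map_smul, map_smul, smul_eq_mul, smul_eq_mul]
    simp only [smul_eq_mul] at h1 ⊢
    rw [h2]
    linarith
  obtain ⟨κ, hκ, N, hN, hgr⟩ := hgrowth w hw
  have hloc : IsLocalMinOn (fun u => (P.h u).toReal - D (u - w)) (effDomain P.h) w := by
    have : effDomain P.h ∩ N ∈ 𝓝[effDomain P.h] w :=
      Filter.inter_mem self_mem_nhdsWithin (mem_nhdsWithin_of_mem_nhds hN)
    filter_upwards [this] with u hu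
    have h1 := hgr u hu.2
    rw [← hP.coe_toReal hw, ← hP.coe_toReal hu.1, ← EReal.coe_add, EReal.coe_le_coe_iff] at h1
    rw [sub_self, map_zero, sub_zero]
    have : 0 ≤ κ * ‖u - w‖ ^ 2 := by positivity
    linarith
  have h := IsMinOn.of_isLocalMinOn_of_convexOn hw hloc hconv hw'
  change (P.h w).toReal - D (w - w) ≤ (P.h w').toReal - D (w' - w) at h
  rw [sub_self, map_zero, sub_zero] at h
  linarith

theorem le_conjugate_add (hP : P.IsAdmissible) {x : W} (hx : x ∈ effDomain P.h) (u : W) :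
    ((⟪x, u⟫ - (P.h x).toReal : ℝ) : EReal) ≤ conjugate P.h u := by
  rw [EReal.coe_sub, hP.coe_toReal hx]
  exact le_iSup (fun x => ((⟪x, u⟫ : ℝ) : EReal) - P.h x) x

theorem conjugate_ne_bot (hP : P.IsAdmissible) (u : W) : conjugate P.h u ≠ ⊥ := by
  obtain ⟨x, hx⟩ := hP.dom_nonempty
  exact ne_bot_of_le_ne_bot (EReal.coe_ne_bot _) (le_conjugate_add hP hx u)

/-- The conjugate at a subgradient. -/
theorem conjugate_eq_of_subgradient (hP : P.IsAdmissible) {x u : W} (hx : x ∈ effDomain P.h)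
    (h : ∀ x' ∈ effDomain P.h, (P.h x).toReal + ⟪u, x' - x⟫ ≤ (P.h x').toReal) :
    conjugate P.h u = ((⟪x, u⟫ - (P.h x).toReal : ℝ) : EReal) := by
  refine le_antisymm (iSup_le fun x' => ?_) (le_conjugate_add hP hx u)
  by_cases hx' : x' ∈ effDomain P.h
  · rw [← hP.coe_toReal hx', ← EReal.coe_sub, EReal.coe_le_coe_iff]
    have := h x' hx'
    rw [inner_sub_right, real_inner_comm, real_inner_comm x u] at this
    linarith
  · have : P.h x' = ⊤ := not_lt_top_iff.1 hx'
    rw [this, EReal.sub_top]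
    exact bot_le

variable [FiniteDimensional ℝ W]

/-- The gradient is a global subgradient, so equality holds in Fenchel–Young. This supplies points
at which h* is finite, for testing the Lagrangian. -/
theorem exists_gradient (hP : P.IsAdmissible) (hgrowth : P.LocalGrowth) {x : W}
    (hx : x ∈ effDomain P.h) :
    ∃ u : W, conjugate P.h u = ((⟪x, u⟫ - (P.h x).toReal : ℝ) : EReal) := by
  have : CompleteSpace W := FiniteDimensional.complete ℝ W
  refine ⟨(InnerProductSpace.toDual ℝ W).symm (fderiv ℝ (fun u => (P.h u).toReal) x),
    conjugate_eq_of_subgradient hP hx fun x' hx' => ?_⟩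
  rw [InnerProductSpace.toDual_symm_apply]
  exact hP.add_fderiv_le hgrowth hx hx'

variable [FiniteDimensional ℝ Y]

theorem lagrangian_eq {y : Y} {w : W} {S : SymMat n} (hy : y ∈ P.Q) (hS : S ∈ psdCone n) {c : ℝ}
    (hc : conjugate P.h (-w) = c) (X : SymMat n) :
    P.lagrangian (y, w, S) X =
      ((c - ⟪P.b - P.A X, y⟫ + ⟪P.F X, w⟫ + ⟪X, S⟫ - ⟪P.C, X⟫ : ℝ) : EReal) := by
  rw [lagrangian, indicatorFn, indicatorFn, if_pos hy, if_pos hS, hc, zero_add, add_zero,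
    ← EReal.coe_add, ← EReal.coe_add, EReal.coe_eq_coe_iff]
  simp only [inner_sub_right, inner_add_right, LinearMap.adjoint_inner_right, inner_sub_left,
    real_inner_comm P.C X]
  ring

theorem lagrangian_eq_top_or (hP : P.IsAdmissible) (z : Y × W × SymMat n) (X : SymMat n) :
    P.lagrangian z X = ⊤ ∨
      z.1 ∈ P.Q ∧ z.2.2 ∈ psdCone n ∧ ∃ c : ℝ, conjugate P.h (-z.2.1) = c := by
  have hconj := conjugate_ne_bot hP (-z.2.1)
  rw [lagrangian]
  generalize conjugate P.h (-z.2.1) = K at hconj ⊢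
  by_cases hy : z.1 ∈ P.Q <;> by_cases hS : z.2.2 ∈ psdCone n <;> induction K <;>
    simp_all [indicatorFn]

theorem le_lagrangian (hP : P.IsAdmissible) {X : SymMat n} (hX : X ∈ psdCone n)
    (hF : P.F X ∈ effDomain P.h) (hA : X ∈ P.constraintSet) (z : Y × W × SymMat n) :
    ((-P.realObjective X : ℝ) : EReal) ≤ P.lagrangian z X := by
  obtain ⟨y, w, S⟩ := z
  rcases lagrangian_eq_top_or hP (y, w, S) X with htop | ⟨hy, hS, c, hceq⟩
  · rw [htop]
    exact le_top
  rw [lagrangian_eq hy hS hceq, EReal.coe_le_coe_iff, realObjective]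
  have h1 := le_conjugate_add hP hF (-w)
  rw [hceq, EReal.coe_le_coe_iff, inner_neg_right] at h1
  have h2 := hA y hy
  have h3 := inner_nonneg_of_mem_psdCone hX hS
  linarith

/-- The dual function is the negative of the objective on the feasible set. -/
theorem phi_eq (hP : P.IsAdmissible) (hgrowth : P.LocalGrowth) {X : SymMat n}
    (hX : X ∈ psdCone n) (hF : P.F X ∈ effDomain P.h) (hA : X ∈ P.constraintSet) :
    P.phi X = ((-P.realObjective X : ℝ) : EReal) := by
  refine le_antisymm ?_ (le_iInf fun z => le_lagrangian hP hX hF hA z)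
  -- With u = ∇h(F X), the triple (0, -u, 0) attains the infimum.
  obtain ⟨u, hu⟩ := exists_gradient hP hgrowth hF
  refine (iInf_le _ (0, -u, 0)).trans ?_
  rw [lagrangian_eq hP.zero_mem zero_mem_psdCone (c := ⟪P.F X, u⟫ - (P.h (P.F X)).toReal)
    (by rw [neg_neg, hu]), EReal.coe_le_coe_iff, realObjective, inner_neg_right, inner_zero_right,
    inner_zero_right]
  linarith

/-- The dual function is `-∞` outside the feasible set. -/
theorem mem_of_phi_ne_bot (hP : P.IsAdmissible) (hgrowth : P.LocalGrowth) {X : SymMat n}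
    (h : P.phi X ≠ ⊥) : X ∈ psdCone n ∧ X ∈ P.constraintSet := by
  obtain ⟨x, hx⟩ := hP.dom_nonempty
  obtain ⟨u, hu⟩ := exists_gradient hP hgrowth hx
  rw [← neg_neg u] at hu
  -- A ray of dual points on which the Lagrangian is affine with negative slope forces φ(X) = -∞. A
  -- violated constraint provides such a ray.
  have key : ∀ α β : ℝ, β < 0 → (∀ t : ℝ, 0 ≤ t → P.phi X ≤ ((α + t * β : ℝ) : EReal)) → False := by
    intro α β hβ hle
    refine h ((EReal.eq_bot_iff_forall_lt _).2 fun y => ?_)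
    set t := (|α - y| + 1) / (-β) with ht
    have htβ : t * β = -(|α - y| + 1) := by
      rw [ht, div_neg, neg_mul, div_mul_cancel₀ _ hβ.ne]
    refine (hle t (div_nonneg (by positivity) (by linarith))).trans_lt ?_
    rw [EReal.coe_lt_coe_iff, htβ]
    linarith [le_abs_self (α - y)]
  constructor
  · by_contra hX
    obtain ⟨S, hS, hneg⟩ := exists_mem_psdCone_inner_neg hX
    refine key (⟪x, - -u⟫ - (P.h x).toReal - ⟪P.b - P.A X, 0⟫ + ⟪P.F X, -u⟫ - ⟪P.C, X⟫) _ hneg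
      fun t ht => (iInf_le _ (0, -u, t • S)).trans (le_of_eq ?_)
    rw [lagrangian_eq hP.zero_mem (smul_mem_psdCone hS ht) hu, EReal.coe_eq_coe_iff,
      SymMat.inner_smul_right]
    exact add_sub_right_comm _ _ _
  · intro y hy
    by_contra hpos
    refine key (⟪x, - -u⟫ - (P.h x).toReal + ⟪P.F X, -u⟫ - ⟪P.C, X⟫) (-⟪P.b - P.A X, y⟫)
      (by linarith) fun t ht => (iInf_le _ (t • y, -u, 0)).trans (le_of_eq ?_)
    rw [lagrangian_eq (hP.smul_mem hy ht) zero_mem_psdCone hu, EReal.coe_eq_coe_iff,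
      inner_smul_right, inner_zero_right]
    ring

/-- The dual function is an infimum of affine functions, hence quasiconcave. -/
theorem le_phi_convexCombo {X Z : SymMat n} {a t : ℝ} (hX : (a : EReal) ≤ P.phi X)
    (hZ : (a : EReal) ≤ P.phi Z) (ht : 0 ≤ t) (ht1 : t ≤ 1) :
    (a : EReal) ≤ P.phi (X + t • (Z - X)) := by
  refine le_iInf fun z => ?_
  have h1 := hX.trans (iInf_le _ z)
  have h2 := hZ.trans (iInf_le _ z)
  rw [lagrangian] at h1 h2 ⊢
  generalize indicatorFn P.Q z.1 + ((-⟪P.b, z.1⟫ : ℝ) : EReal) + conjugate P.h (-z.2.1)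
    + indicatorFn (psdCone n) z.2.2 = K at h1 h2 ⊢
  generalize LinearMap.adjoint P.A z.1 + LinearMap.adjoint P.F z.2.1 + z.2.2 - P.C = g at h1 h2 ⊢
  induction K with
  | bot => simp at h1
  | top => simp
  | coe k =>
    rw [← EReal.coe_add, EReal.coe_le_coe_iff] at h1 h2 ⊢
    rw [inner_add_left, SymMat.inner_smul_left, inner_sub_left]
    nlinarith

end Duality

end Problem

theorem exists_norm_map_le {E G : Type*} [NormedAddCommGroup E] [NormedSpace ℝ E]
    [FiniteDimensional ℝ E] [NormedAddCommGroup G] [NormedSpace ℝ G] (f : E →ₗ[ℝ] G) :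
    ∃ c : ℝ, 0 ≤ c ∧ ∀ x, ‖f x‖ ≤ c * ‖x‖ :=
  ⟨‖LinearMap.toContinuousLinearMap f‖, norm_nonneg _,
    (LinearMap.toContinuousLinearMap f).le_opNorm⟩

namespace Problem

/-! ### Consequences of the KKT system: gap identity, dual maximizers, polyhedral error bound. -/

section KKT

variable {n : ℕ} {Y W : Type*} [NormedAddCommGroup Y] [InnerProductSpace ℝ Y]
  [FiniteDimensional ℝ Y] [NormedAddCommGroup W] [InnerProductSpace ℝ W] [FiniteDimensional ℝ W]
  {P : Problem n Y W} {Xb : SymMat n} {y : Y} {w : W} {S : SymMat n}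

/-- The KKT system at a feasible point `Xb` of finite objective value, unfolded: feasibility,
complementarity and stationarity. -/
structure IsKKT (P : Problem n Y W) (Xb : SymMat n) (y : Y) (w : W) (S : SymMat n) : Prop where
  psd : Xb ∈ psdCone n
  dom : P.F Xb ∈ effDomain P.h
  feasible : Xb ∈ P.constraintSet
  mem_Q : y ∈ P.Q
  compl_Q : ⟪y, P.b - P.A Xb⟫ = 0
  psd_S : S ∈ psdCone n
  compl_S : ⟪S, Xb⟫ = 0
  conj_eq : conjugate P.h (-w) = ((-⟪P.F Xb, w⟫ - (P.h (P.F Xb)).toReal : ℝ) : EReal)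
  fderiv_eq : ∀ v, fderiv ℝ (fun u => (P.h u).toReal) (P.F Xb) v = -⟪w, v⟫
  stationary : P.C = LinearMap.adjoint P.A y + LinearMap.adjoint P.F w + S

theorem isKKT_of_mem_multipliers (hP : P.IsAdmissible) (hgrowth : P.LocalGrowth)
    (hXb : Xb ∈ P.solutionSet) (hz : (y, w, S) ∈ P.multipliers Xb) : P.IsKKT Xb y w S := by
  obtain ⟨⟨hy, hyN⟩, hw, ⟨hS, hSN⟩, hstat⟩ := hz
  obtain ⟨hpsd, hdom⟩ := hP.mem_of_objective_lt_top hXb.2.1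
  have hconj : conjugate P.h (-w) =
      ((-⟪P.F Xb, w⟫ - (P.h (P.F Xb)).toReal : ℝ) : EReal) := by
    have hge := le_conjugate_add hP hdom (-w)
    rw [inner_neg_right] at hge
    refine le_antisymm ?_ hge
    -- Testing F Xb ∈ ∂h*(-w) at u = ∇h(F Xb), where h* is known, yields the reverse Fenchel–Young
    -- inequality at -w.
    obtain ⟨u, hu⟩ := exists_gradient hP hgrowth hdom
    have h1 : conjugate P.h (-w) + ((⟪P.F Xb, u - -w⟫ : ℝ) : EReal) ≤ conjugate P.h u := hw u
    rw [hu] at h1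
    generalize conjugate P.h (-w) = K at h1 ⊢
    induction K with
    | bot => exact bot_le
    | top =>
      rw [EReal.top_add_coe, top_le_iff] at h1
      exact absurd h1 (EReal.coe_ne_top _)
    | coe k =>
      rw [← EReal.coe_add, EReal.coe_le_coe_iff, sub_neg_eq_add, inner_add_right] at h1
      rw [EReal.coe_le_coe_iff]
      linarith
  refine ⟨hpsd, hdom, hXb.1, hy, ?_, hS, ?_, hconj, fun v => ?_, sub_eq_zero.1 hstat⟩
  · have h1 := hyN 0 hP.zero_mem
    have h2 := hXb.1 y hy
    simp only [zero_sub, inner_neg_right] at h1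
    rw [real_inner_comm]
    linarith
  · have h1 := hSN 0 zero_mem_psdCone
    have h2 := inner_nonneg_of_mem_psdCone hS hpsd
    simp only [zero_sub, inner_neg_right, inner_neg_left, neg_neg] at h1
    have h3 := real_inner_comm S Xb
    linarith
  · have hdiff : DifferentiableAt ℝ (fun u => (P.h u).toReal) (P.F Xb) :=
      (hP.contDiff.differentiableOn one_ne_zero).differentiableAt (hP.dom_open.mem_nhds hdom)
    -- Equality in Fenchel–Young says that F Xb minimizes h + ⟨w, ·⟩, whence ∇h(F Xb) = -w.
    have hmin : IsLocalMin (fun u => (P.h u).toReal + innerSL ℝ w u) (P.F Xb) := by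
      filter_upwards [hP.dom_open.mem_nhds hdom] with x hx
      have h1 := le_conjugate_add hP hx (-w)
      rw [hconj, EReal.coe_le_coe_iff, inner_neg_right] at h1
      rw [innerSL_apply_apply, innerSL_apply_apply, real_inner_comm, real_inner_comm x w]
      linarith
    have h0 := hmin.fderiv_eq_zero
    rw [fderiv_fun_add hdiff (innerSL ℝ w).differentiableAt, ContinuousLinearMap.fderiv] at h0
    have h1 := congrArg (fun L : W →L[ℝ] ℝ => L v) h0
    simp only [_root_.add_apply, innerSL_apply_apply,
      _root_.zero_apply] at h1
    linarith

/-- Stationarity splits ⟨C, X - Xb⟩ into pairings with y, w and S, and complementarity cancels the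
contributions of y and S at Xb. For feasible X with F X ∈ dom h each of the three summands is
nonnegative. -/
theorem IsKKT.realObjective_sub (hk : P.IsKKT Xb y w S) (X : SymMat n) :
    P.realObjective X - P.realObjective Xb =
      ((P.h (P.F X)).toReal - (P.h (P.F Xb)).toReal + ⟪w, P.F X - P.F Xb⟫)
        + -⟪y, P.b - P.A X⟫ + ⟪S, X⟫ := by
  have h1 := hk.compl_Q
  have h2 := hk.compl_S
  rw [realObjective, realObjective, hk.stationary]
  simp only [inner_add_left, LinearMap.adjoint_inner_left, inner_sub_right] at h1 ⊢
  linarith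

theorem IsKKT.tangent_gap_nonneg (hP : P.IsAdmissible) (hgrowth : P.LocalGrowth)
    (hk : P.IsKKT Xb y w S) {x : W} (hx : x ∈ effDomain P.h) :
    0 ≤ (P.h x).toReal - (P.h (P.F Xb)).toReal + ⟪w, x - P.F Xb⟫ := by
  have := hP.add_fderiv_le hgrowth hk.dom hx
  rw [hk.fderiv_eq] at this
  linarith

theorem IsKKT.inner_nonpos (hk : P.IsKKT Xb y w S) {X : SymMat n} (hX : X ∈ P.constraintSet) :
    ⟪y, P.b - P.A X⟫ ≤ 0 := by
  rw [real_inner_comm]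
  exact hX y hk.mem_Q

theorem IsKKT.realObjective_le (hP : P.IsAdmissible) (hgrowth : P.LocalGrowth)
    (hk : P.IsKKT Xb y w S) {X : SymMat n} (hX : X ∈ psdCone n) (hF : P.F X ∈ effDomain P.h)
    (hA : X ∈ P.constraintSet) : P.realObjective Xb ≤ P.realObjective X := by
  have h1 := hk.realObjective_sub X
  have h2 := hk.tangent_gap_nonneg hP hgrowth hF
  have h3 := hk.inner_nonpos hA
  have h4 := inner_nonneg_of_mem_psdCone hk.psd_S hX
  linarith

theorem IsKKT.coe_realObjective_le (hP : P.IsAdmissible) (hgrowth : P.LocalGrowth)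
    (hk : P.IsKKT Xb y w S) {X : SymMat n} (hA : X ∈ P.constraintSet) :
    (P.realObjective Xb : EReal) ≤ P.objective X := by
  rcases eq_or_ne (P.objective X) ⊤ with htop | htop
  · rw [htop]; exact le_top
  · obtain ⟨hX, hF⟩ := hP.mem_of_objective_lt_top (lt_top_iff_ne_top.2 htop)
    rw [hP.objective_eq hX hF, EReal.coe_le_coe_iff]
    exact hk.realObjective_le hP hgrowth hX hF hA

theorem IsKKT.mem_solutionSet_of_le (hP : P.IsAdmissible) (hgrowth : P.LocalGrowth)
    (hk : P.IsKKT Xb y w S) {X : SymMat n} (hX : X ∈ psdCone n) (hF : P.F X ∈ effDomain P.h)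
    (hA : X ∈ P.constraintSet) (hle : P.realObjective X ≤ P.realObjective Xb) :
    X ∈ P.solutionSet := by
  refine ⟨hA, ?_, fun X' hX' => ?_⟩ <;> rw [hP.objective_eq hX hF]
  · exact EReal.coe_lt_top _
  · exact (EReal.coe_le_coe_iff.2 hle).trans (hk.coe_realObjective_le hP hgrowth hX')

theorem IsKKT.realObjective_eq_of_mem (hP : P.IsAdmissible) (hgrowth : P.LocalGrowth)
    (hk : P.IsKKT Xb y w S) {X : SymMat n} (hX : X ∈ P.solutionSet) :
    P.realObjective X = P.realObjective Xb := by
  obtain ⟨hpsd, hF⟩ := hP.mem_of_objective_lt_top hX.2.1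
  refine le_antisymm ?_ (hk.realObjective_le hP hgrowth hpsd hF hX.1)
  have := hX.2.2 Xb hk.feasible
  rwa [hP.objective_eq hpsd hF, hP.objective_eq hk.psd hk.dom, EReal.coe_le_coe_iff] at this

/-- Weak duality: the dual function is bounded by the dual value at a KKT multiplier. -/
theorem IsKKT.phi_le (hk : P.IsKKT Xb y w S) (X : SymMat n) :
    P.phi X ≤ ((-P.realObjective Xb : ℝ) : EReal) := by
  refine (iInf_le _ (y, w, S)).trans ?_
  rw [lagrangian_eq hk.mem_Q hk.psd_S hk.conj_eq, EReal.coe_le_coe_iff, realObjective,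
    hk.stationary]
  have h1 := hk.compl_Q
  have h2 := hk.compl_S
  simp only [inner_add_left, LinearMap.adjoint_inner_left, inner_sub_right, inner_sub_left] at h1 ⊢
  rw [real_inner_comm y P.b, real_inner_comm y (P.A X), real_inner_comm w (P.F X),
    real_inner_comm S X, real_inner_comm w (P.F Xb)]
  linarith

/-- All maximizers of the dual function have the same image under `F`. -/
theorem IsKKT.map_F_eq_of_le_phi (hP : P.IsAdmissible) (hgrowth : P.LocalGrowth)
    (hk : P.IsKKT Xb y w S) {X : SymMat n}
    (hX : ((-P.realObjective Xb : ℝ) : EReal) ≤ P.phi X) : P.F X = P.F Xb := by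
  obtain ⟨κ, hκ, N, hN, hgr⟩ := hgrowth _ hk.dom
  have hcont : Continuous fun t : ℝ => P.F (Xb + t • (X - Xb)) := by
    have hFc : Continuous P.F := P.F.continuous_of_finiteDimensional
    fun_prop
  have hev : ∀ᶠ t in 𝓝 (0 : ℝ), P.F (Xb + t • (X - Xb)) ∈ N ∩ effDomain P.h :=
    hcont.tendsto' 0 (P.F Xb) (by simp) (Filter.inter_mem hN (hP.dom_open.mem_nhds hk.dom))
  -- F X itself may lie outside dom h, where φ is not known to be -θ; the gap is therefore examined
  -- at a point of the segment close to Xb.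
  obtain ⟨t, ⟨htN, htd⟩, ht0, ht1⟩ : ∃ t : ℝ, P.F (Xb + t • (X - Xb)) ∈ N ∩ effDomain P.h ∧
      0 < t ∧ t < 1 := by
    have h1 : ∀ᶠ t in 𝓝[>] (0 : ℝ), t ∈ Set.Ioo (0 : ℝ) 1 := Ioo_mem_nhdsGT one_pos
    obtain ⟨t, ht, ht'⟩ := ((hev.filter_mono nhdsWithin_le_nhds).and h1).exists
    exact ⟨t, ht, ht'⟩
  set Z := Xb + t • (X - Xb) with hZ
  have hphi : ((-P.realObjective Xb : ℝ) : EReal) ≤ P.phi Z :=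
    le_phi_convexCombo (phi_eq hP hgrowth hk.psd hk.dom hk.feasible).ge hX ht0.le ht1.le
  obtain ⟨hZp, hZA⟩ := mem_of_phi_ne_bot hP hgrowth
    (ne_bot_of_le_ne_bot (EReal.coe_ne_bot _) hphi)
  rw [phi_eq hP hgrowth hZp htd hZA, EReal.coe_le_coe_iff] at hphi
  have h1 := hk.realObjective_sub Z
  have h2 := hgr _ htN
  rw [← hP.coe_toReal hk.dom, ← hP.coe_toReal htd, ← EReal.coe_add, EReal.coe_le_coe_iff,
    hk.fderiv_eq] at h2
  have h3 := hk.inner_nonpos hZA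
  have h4 := inner_nonneg_of_mem_psdCone hk.psd_S hZp
  have h5 : κ * ‖P.F Z - P.F Xb‖ ^ 2 ≤ 0 := by linarith
  have h6 : ‖P.F Z - P.F Xb‖ ^ 2 = 0 :=
    le_antisymm (nonpos_of_mul_nonpos_right h5 hκ) (sq_nonneg _)
  have h7 : P.F Z - P.F Xb = t • (P.F X - P.F Xb) := by
    rw [hZ, map_add, map_smul, map_sub, add_sub_cancel_left]
  rw [pow_eq_zero_iff two_ne_zero, norm_eq_zero, h7, smul_eq_zero] at h6
  exact sub_eq_zero.1 (h6.resolve_left ht0.ne')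

theorem IsKKT.phi_eq_of_mem (hP : P.IsAdmissible) (hgrowth : P.LocalGrowth)
    (hk : P.IsKKT Xb y w S) {X : SymMat n} (hX : X ∈ P.solutionSet) :
    P.phi X = ((-P.realObjective Xb : ℝ) : EReal) := by
  obtain ⟨hpsd, hF⟩ := hP.mem_of_objective_lt_top hX.2.1
  rw [phi_eq hP hgrowth hpsd hF hX.1, hk.realObjective_eq_of_mem hP hgrowth hX]

theorem IsKKT.map_F_eq_of_mem (hP : P.IsAdmissible) (hgrowth : P.LocalGrowth)
    (hk : P.IsKKT Xb y w S) {X : SymMat n} (hX : X ∈ P.solutionSet) : P.F X = P.F Xb :=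
  hk.map_F_eq_of_le_phi hP hgrowth (hk.phi_eq_of_mem hP hgrowth hX).ge

theorem zero_mem_Tphi_iff {X : SymMat n} : 0 ∈ P.Tphi X ↔ ∀ Z, P.phi Z ≤ P.phi X := by
  simp [Tphi, superdifferential]

/-- The zeros of `T_φ` are the optimal solutions. -/
theorem IsKKT.setOf_zero_mem_Tphi (hP : P.IsAdmissible) (hgrowth : P.LocalGrowth)
    (hk : P.IsKKT Xb y w S) : {X | 0 ∈ P.Tphi X} = P.solutionSet := by
  ext X
  change 0 ∈ P.Tphi X ↔ _
  rw [zero_mem_Tphi_iff]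
  constructor
  · intro h
    have hle : ((-P.realObjective Xb : ℝ) : EReal) ≤ P.phi X := by
      rw [← phi_eq hP hgrowth hk.psd hk.dom hk.feasible]
      exact h Xb
    have hF : P.F X ∈ effDomain P.h := by
      rw [hk.map_F_eq_of_le_phi hP hgrowth hle]
      exact hk.dom
    obtain ⟨hpsd, hA⟩ := mem_of_phi_ne_bot hP hgrowth
      (ne_bot_of_le_ne_bot (EReal.coe_ne_bot _) hle)
    rw [phi_eq hP hgrowth hpsd hF hA, EReal.coe_le_coe_iff, neg_le_neg_iff] at hle
    exact hk.mem_solutionSet_of_le hP hgrowth hpsd hF hA hle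
  · intro hX Z
    rw [hk.phi_eq_of_mem hP hgrowth hX]
    exact hk.phi_le Z

/-- Error bound for the polyhedral part of the optimality system within the range of a linear
projection. -/
theorem IsKKT.exists_polyhedral_error_bound (hP : P.IsAdmissible) (hk : P.IsKKT Xb y w S)
    (L : SymMat n →ₗ[ℝ] SymMat n) (hLXb : L Xb = Xb) :
    ∃ c : ℝ, 0 ≤ c ∧ ∀ X ∈ P.constraintSet, ∃ Z, P.F (L Z) = P.F Xb ∧ L Z ∈ P.constraintSet ∧
      ⟪y, P.b - P.A (L Z)⟫ = 0 ∧ ‖L Z - L X‖ ≤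
        c * (‖X - L X‖ + ‖P.F X - P.F Xb‖ + |⟪y, P.b - P.A X⟫|) := by
  have : CompleteSpace Y := FiniteDimensional.complete ℝ Y
  obtain ⟨s, hs⟩ := hP.polyhedral
  let e := Module.finBasis ℝ (SymMat n)
  -- The unknowns are the coordinates of X, which are free, and nonnegative coefficients expressing
  -- the slack b - A X through the generators of Q°.
  let ι := Fin (Module.finrank ℝ (SymMat n)) ⊕ s
  let x : EuclideanSpace ℝ ι →ₗ[ℝ] SymMat n :=
    { toFun u := ∑ i, u (Sum.inl i) • e i
      map_add' u v := by simp [add_smul, Finset.sum_add_distrib]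
      map_smul' t u := by simp [Finset.smul_sum, mul_smul] }
  let l : EuclideanSpace ℝ ι →ₗ[ℝ] Y :=
    { toFun u := ∑ a : s, u (Sum.inr a) • (a : Y)
      map_add' u v := by simp [add_smul, Finset.sum_add_distrib]
      map_smul' t u := by simp [Finset.smul_sum, mul_smul] }
  -- The linear system is A(L X) + l = b, F(L X) = F Xb, ⟨y, l⟩ = 0. The lift of Xb solves it
  -- exactly; the lift of X has its slack computed at X, not at L X, so the residual contains ‖X - L
  -- X‖.
  let B : EuclideanSpace ℝ ι →ₗ[ℝ] Y × W × ℝ :=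
    (P.A ∘ₗ L ∘ₗ x + l).prod ((P.F ∘ₗ L ∘ₗ x).prod ((innerSL ℝ y).toLinearMap ∘ₗ l))
  have hB : ∀ u, B u = (P.A (L (x u)) + l u, P.F (L (x u)), ⟪y, l u⟫) := fun u => rfl
  let I : Set ι := Set.range Sum.inr
  have hlift : ∀ X ∈ P.constraintSet, ∃ u : EuclideanSpace ℝ ι, (∀ i ∈ I, 0 ≤ u i) ∧ x u = X ∧
      l u = P.b - P.A X := by
    intro X hX
    have hX' : P.b - P.A X ∈ polarCone {x : Y | ∀ a ∈ s, ⟪a, x⟫ ≤ 0} := by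
      rw [← hs]; exact hX
    obtain ⟨μ, hμ, hsum⟩ := exists_nonneg_sum_of_mem_polarCone s hX'
    refine ⟨WithLp.toLp 2 (Sum.elim (fun i => e.repr X i) μ), ?_, ?_, ?_⟩
    · rintro _ ⟨a, rfl⟩
      exact hμ a
    · exact e.sum_repr X
    · exact hsum
  have hpolar : ∀ u : EuclideanSpace ℝ ι, (∀ i ∈ I, 0 ≤ u i) → l u ∈ polarCone P.Q := by
    intro u hu d hd
    rw [hs] at hd
    change ⟪∑ a : s, u (Sum.inr a) • (a : Y), d⟫ ≤ 0
    rw [sum_inner]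
    refine Finset.sum_nonpos fun a _ => ?_
    rw [real_inner_smul_left]
    exact mul_nonpos_of_nonneg_of_nonpos (hu _ ⟨a, rfl⟩) (hd a a.2)
  obtain ⟨c, hc, hH⟩ := exists_hoffman_constant B I
  obtain ⟨cx, hcx, hx⟩ := exists_norm_map_le (L ∘ₗ x)
  obtain ⟨cA, hcA, hA⟩ := exists_norm_map_le P.A
  obtain ⟨cF, hcF, hF⟩ := exists_norm_map_le P.F
  obtain ⟨v, hv, hxv, hlv⟩ := hlift Xb hk.feasible
  refine ⟨cx * (c * (cA + cF + 1)), by positivity, fun X hX => ?_⟩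
  obtain ⟨u, hu, hxu, hlu⟩ := hlift X hX
  obtain ⟨v', hv', hBv', hnorm⟩ := hH u v hu hv
  rw [hB, hB, hxv, hlv, hLXb, add_sub_cancel, hk.compl_Q, Prod.mk.injEq, Prod.mk.injEq] at hBv'
  obtain ⟨h1, h2, h3⟩ := hBv'
  have h4 : P.b - P.A (L (x v')) = l v' := by rw [← h1, add_sub_cancel_left]
  refine ⟨x v', h2, ?_, by rw [h4, h3], ?_⟩
  · change P.b - P.A (L (x v')) ∈ polarCone P.Q
    rw [h4]
    exact hpolar v' hv'
  have hres : ‖B v - B u‖ ≤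
      (cA + cF + 1) * (‖X - L X‖ + ‖P.F X - P.F Xb‖ + |⟪y, P.b - P.A X⟫|) := by
    have e1 : B v - B u = (P.A (X - L X), P.F (X - L X) - (P.F X - P.F Xb),
        -⟪y, P.b - P.A X⟫) := by
      rw [hB, hB, hxv, hlv, hLXb, hxu, hlu, hk.compl_Q, add_sub_cancel]
      simp only [Prod.mk_sub_mk, map_sub, zero_sub, Prod.mk.injEq, and_true]
      constructor <;> abel
    have e2 := hA (X - L X)
    have e3 := hF (X - L X)
    have e4 := norm_sub_le (P.F (X - L X)) (P.F X - P.F Xb)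
    have n1 := norm_nonneg (X - L X)
    have n2 := norm_nonneg (P.F X - P.F Xb)
    have n3 := abs_nonneg ⟪y, P.b - P.A X⟫
    have m1 := mul_nonneg hcA n1
    have m2 := mul_nonneg hcF n1
    have m3 := mul_nonneg hcA n2
    have m4 := mul_nonneg hcF n2
    have m5 := mul_nonneg hcA n3
    have m6 := mul_nonneg hcF n3
    rw [e1, Prod.norm_def, Prod.norm_def]
    simp only [norm_neg, Real.norm_eq_abs]
    refine max_le ?_ (max_le ?_ ?_) <;> linarith
  calc ‖L (x v') - L X‖ = ‖(L ∘ₗ x) (v' - u)‖ := by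
        rw [map_sub, LinearMap.comp_apply, LinearMap.comp_apply, hxu]
    _ ≤ cx * ‖v' - u‖ := hx _
    _ ≤ cx * (c * ‖B v - B u‖) := by gcongr
    _ ≤ cx * (c * ((cA + cF + 1) *
        (‖X - L X‖ + ‖P.F X - P.F Xb‖ + |⟪y, P.b - P.A X⟫|))) := by gcongr
    _ = _ := by ring

end KKT

/-! ### Distance to the solution set, quadratic growth and metric subregularity. -/

section Growth

variable {n : ℕ} {Y W : Type*} [NormedAddCommGroup Y] [InnerProductSpace ℝ Y]
  [FiniteDimensional ℝ Y] [NormedAddCommGroup W] [InnerProductSpace ℝ W] [FiniteDimensional ℝ W]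
  {P : Problem n Y W} {Xb : SymMat n} {y : Y} {w : W} {S : SymMat n}

/-- The optimality conditions on F, A, y and S are linear or convex and hold at both Z and Xb. Only
semidefiniteness has to be assumed of the combination. -/
theorem IsKKT.convexCombo_mem_solutionSet (hP : P.IsAdmissible) (hgrowth : P.LocalGrowth)
    (hk : P.IsKKT Xb y w S) {Z : SymMat n} (hFZ : P.F Z = P.F Xb) (hAZ : Z ∈ P.constraintSet)
    (hyZ : ⟪y, P.b - P.A Z⟫ = 0) (hSZ : ⟪S, Z⟫ = 0) {t : ℝ} (ht0 : 0 ≤ t) (ht1 : t ≤ 1)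
    (hpsd : (1 - t) • Z + t • Xb ∈ psdCone n) : (1 - t) • Z + t • Xb ∈ P.solutionSet := by
  set Z' := (1 - t) • Z + t • Xb with hZ'
  have hF' : P.F Z' = P.F Xb := by
    rw [hZ', map_add, map_smul, map_smul, hFZ, ← add_smul, sub_add_cancel, one_smul]
  have hb : P.b - P.A Z' = (1 - t) • (P.b - P.A Z) + t • (P.b - P.A Xb) := by
    rw [hZ', map_add, map_smul, map_smul, smul_sub, smul_sub, sub_smul, sub_smul, one_smul,
      one_smul]
    abel
  have hA' : Z' ∈ P.constraintSet := by
    intro q hq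
    rw [hb, inner_add_left, real_inner_smul_left, real_inner_smul_left]
    have h1 := mul_nonpos_of_nonneg_of_nonpos (sub_nonneg.2 ht1) (hAZ q hq)
    have h2 := mul_nonpos_of_nonneg_of_nonpos ht0 (hk.feasible q hq)
    linarith
  refine hk.mem_solutionSet_of_le hP hgrowth hpsd (by rw [hF']; exact hk.dom) hA' ?_
  have hy' : ⟪y, P.b - P.A Z'⟫ = 0 := by
    rw [hb, inner_add_right, real_inner_smul_right, real_inner_smul_right, hyZ, hk.compl_Q]
    simp
  have hS' : ⟪S, Z'⟫ = 0 := by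
    rw [hZ', inner_add_right, SymMat.inner_smul_right, SymMat.inner_smul_right, hSZ, hk.compl_S]
    simp
  have h1 := hk.realObjective_sub Z'
  rw [hF', hy', hS', sub_self, sub_self, inner_zero_right] at h1
  linarith

/-- Bookkeeping for the error bound: the residuals d, a, β are all O(√g), hence so are the
correction D and the distance x. -/
theorem sq_le_of_le_add_mul {x d a β D c K T N g : ℝ} (hx : 0 ≤ x) (hD : 0 ≤ D)
    (hd : d ^ 2 ≤ K * g) (ha : a ^ 2 ≤ g) (hβ : β ^ 2 ≤ T * g) (hDle : D ≤ c * (d + a + β))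
    (hxle : x ≤ d + N * D) :
    x ^ 2 ≤ (2 * K + 2 * N ^ 2 * (3 * c ^ 2 * (K + 1 + T))) * g := by
  have h1 : D ^ 2 ≤ (c * (d + a + β)) ^ 2 := pow_le_pow_left₀ hD hDle 2
  have h2 : (d + a + β) ^ 2 ≤ 3 * (d ^ 2 + a ^ 2 + β ^ 2) := by
    nlinarith [sq_nonneg (d - a), sq_nonneg (d - β), sq_nonneg (a - β)]
  have h3 : (d + a + β) ^ 2 ≤ 3 * ((K + 1 + T) * g) := h2.trans (by linarith)
  have h4 := mul_le_mul_of_nonneg_left h3 (sq_nonneg c)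
  rw [mul_pow] at h1
  have h5 := mul_le_mul_of_nonneg_left (h1.trans h4) (sq_nonneg N)
  have h6 := pow_le_pow_left₀ hx hxle 2
  have h7 : (d + N * D) ^ 2 ≤ 2 * d ^ 2 + 2 * (N ^ 2 * D ^ 2) := by
    nlinarith [sq_nonneg (d - N * D)]
  linarith

/-- The distance to the solution set is controlled by the optimality gap of the KKT system. -/
theorem IsKKT.exists_infDist_sq_le (hP : P.IsAdmissible) (hgrowth : P.LocalGrowth)
    (hk : P.IsKKT Xb y w S) {p : Matrix (Fin n) (Fin n) ℝ} {r : ℝ} (hr : 0 < r)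
    (hpt : p.transpose = p) (hpp : p * p = p) (hSp : S.toMatrix * p = 0)
    (hle : (S.toMatrix - r • (1 - p)).PosSemidef) (hreg : FaceRegular p Xb)
    (hpXb : SymMat.conj p Xb = Xb) (X₀ : SymMat n) :
    ∃ M : ℝ, 0 ≤ M ∧ ∀ X ∈ Metric.closedBall X₀ 1, X ∈ psdCone n → X ∈ P.constraintSet →
      Metric.infDist X P.solutionSet ^ 2 ≤
        M * (‖P.F X - P.F Xb‖ ^ 2 + -⟪y, P.b - P.A X⟫ + ⟪S, X⟫) := by
  set L := SymMat.conj p with hL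
  have hLL : ∀ X, L (L X) = L X := fun X => SymMat.toMatrix_injective (by
    rw [hL, SymMat.toMatrix_conj, SymMat.toMatrix_conj, hpt]
    calc p * (p * X.toMatrix * p) * p = p * p * X.toMatrix * (p * p) := by
          simp only [Matrix.mul_assoc]
      _ = _ := by rw [hpp])
  have hSL : ∀ X, ⟪S, L X⟫ = 0 := fun X => by
    rw [SymMat.inner_eq, hL, SymMat.toMatrix_conj, ← Matrix.mul_assoc, ← Matrix.mul_assoc, hSp]
    simp
  obtain ⟨c, hc, hpoly⟩ := hk.exists_polyhedral_error_bound hP L hpXb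
  obtain ⟨c', hc', hface⟩ := hreg
  obtain ⟨T, hT⟩ : ∃ T : ℝ, ∀ X ∈ Metric.closedBall X₀ 1,
      ‖X.toMatrix.trace‖ + ‖X - L X‖ + ‖P.F X - P.F Xb‖ + |⟪y, P.b - P.A X⟫| + ‖L X‖ ≤ T := by
    have htr : ∀ X : SymMat n, X.toMatrix.trace =
        ⟪SymMat.ofMatrix 1 Matrix.transpose_one, X⟫ := fun X => by
      rw [SymMat.inner_eq, SymMat.toMatrix_ofMatrix, Matrix.one_mul]
    have hcL : Continuous L := L.continuous_of_finiteDimensional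
    have hcF : Continuous P.F := P.F.continuous_of_finiteDimensional
    have hcA : Continuous P.A := P.A.continuous_of_finiteDimensional
    have hcont : Continuous fun X : SymMat n => ‖X.toMatrix.trace‖ + ‖X - L X‖ +
        ‖P.F X - P.F Xb‖ + |⟪y, P.b - P.A X⟫| + ‖L X‖ := by
      simp only [htr]
      fun_prop
    obtain ⟨T, hT⟩ := (isCompact_closedBall X₀ 1).exists_bound_of_continuousOn hcont.continuousOn
    exact ⟨T, fun X hX => (le_abs_self _).trans (hT X hX)⟩
  -- N is the face regularity factor, using ‖Xb - L Z‖ ≤ ‖Xb‖ + T + 3cT; K comes from the bound on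
  -- ‖X - L X‖².
  set N := c' * (1 + (‖Xb‖ + T + c * (3 * T))) with hN
  set K := 2 * T / r with hK
  refine ⟨2 * |K| + 2 * N ^ 2 * (3 * c ^ 2 * (|K| + 1 + |T|)), by positivity,
    fun X hball hX hA => ?_⟩
  have hTX := hT X hball
  set d := ‖X - L X‖ with hd
  set a := ‖P.F X - P.F Xb‖ with ha
  set β := -⟪y, P.b - P.A X⟫ with hβ
  set σ := ⟪S, X⟫ with hσ
  have hd0 : 0 ≤ d := norm_nonneg _
  have ha0 : 0 ≤ a := norm_nonneg _
  have hβ0 : 0 ≤ β := neg_nonneg.2 (hk.inner_nonpos hA)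
  have hσ0 : 0 ≤ σ := inner_nonneg_of_mem_psdCone hk.psd_S hX
  have hβabs : |⟪y, P.b - P.A X⟫| = β := by rw [← abs_neg, ← hβ, abs_of_nonneg hβ0]
  rw [hβabs] at hTX
  have htr0 := norm_nonneg X.toMatrix.trace
  have hLX0 := norm_nonneg (L X)
  have hT0 : 0 ≤ T := by linarith
  have hK0 : 0 ≤ K := by positivity
  rw [abs_of_nonneg hK0, abs_of_nonneg hT0]
  set g := a ^ 2 + β + σ with hg
  have hg0 : 0 ≤ g := by positivity
  have hdsq : d ^ 2 ≤ K * g := by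
    have h1 := norm_sub_conj_sq_le hr hpt hpp hle hX
    rw [← SymMat.inner_eq, ← hσ, ← hL, ← hd] at h1
    have h2 : X.toMatrix.trace ≤ T := (Real.le_norm_self _).trans (by linarith)
    have h3 : 2 * X.toMatrix.trace * σ ≤ 2 * T * g := by
      have h4 : σ ≤ g := by rw [hg]; nlinarith [sq_nonneg a]
      have h5 := mul_le_mul_of_nonneg_right h2 hσ0
      have h6 := mul_le_mul_of_nonneg_left h4 hT0
      linarith
    rw [hK, div_mul_eq_mul_div, le_div_iff₀ hr]
    linarith
  have hasq : a ^ 2 ≤ g := by rw [hg]; linarith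
  -- The gap controls β to first order, whereas the squared distance needs β²; on a bounded set β² ≤
  -- T β.
  have hβsq : β ^ 2 ≤ T * g := by
    have h1 : β ≤ T := by linarith
    have h2 : β ≤ g := by rw [hg]; nlinarith [sq_nonneg a]
    rw [sq]
    exact mul_le_mul h1 h2 hβ0 hT0
  obtain ⟨Z, hFZ, hAZ, hyZ, hZ⟩ := hpoly X hA
  rw [hβabs, ← hd, ← ha] at hZ
  set D := ‖L Z - L X‖ with hD
  have hD0 : 0 ≤ D := norm_nonneg _
  have hDle : D ≤ c * (3 * T) := hZ.trans (mul_le_mul_of_nonneg_left (by linarith) hc)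
  obtain ⟨t, ht0, ht1, hpsd, hdist⟩ := hface (L X) (conj_mem_psdCone p hX) (L Z) (hLL X) (hLL Z)
  set Z' := (1 - t) • L Z + t • Xb with hZ'
  have hmem : Z' ∈ P.solutionSet :=
    hk.convexCombo_mem_solutionSet hP hgrowth hFZ hAZ hyZ (hSL Z) ht0 ht1 hpsd
  have hN' : ‖Z' - L X‖ ≤ N * D := by
    refine hdist.trans (mul_le_mul_of_nonneg_right ?_ hD0)
    refine mul_le_mul_of_nonneg_left ?_ hc'
    have h1 : ‖Xb - L Z‖ ≤ ‖Xb‖ + ‖L Z‖ := norm_sub_le _ _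
    have h2 : ‖L Z‖ ≤ ‖L X‖ + D := by
      have := norm_add_le (L X) (L Z - L X)
      rwa [add_sub_cancel] at this
    linarith
  have hfin : Metric.infDist X P.solutionSet ≤ d + N * D := by
    refine (Metric.infDist_le_dist_of_mem hmem).trans ?_
    rw [dist_eq_norm]
    have h1 := norm_sub_le_norm_sub_add_norm_sub X (L X) Z'
    rw [norm_sub_rev (L X)] at h1
    linarith
  exact sq_le_of_le_add_mul Metric.infDist_nonneg hD0 hdsq hasq hβsq hZ hfin

/-- Under either rank condition, the face exposed by the multiplier `S` is regular at `Xb`, which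
gives the quadratic growth of the real-valued objective near any solution. -/
theorem IsKKT.exists_quadratic_growth (hP : P.IsAdmissible) (hgrowth : P.LocalGrowth)
    (hk : P.IsKKT Xb y w S)
    (hrank : n ≤ S.toMatrix.rank + 1 ∨ Xb.toMatrix.rank + S.toMatrix.rank = n)
    {X₀ : SymMat n} (hX₀ : X₀ ∈ P.solutionSet) :
    ∃ κ : ℝ, 0 < κ ∧ ∃ U ∈ 𝓝 X₀, ∀ X ∈ U, P.F X ∈ effDomain P.h ∧
      (X ∈ psdCone n → X ∈ P.constraintSet →
        P.realObjective Xb + κ * Metric.infDist X P.solutionSet ^ 2 ≤ P.realObjective X) := by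
  obtain ⟨p, r, hr, hpt, hpp, hSp, hle⟩ := exists_kernel_projection hk.psd_S
  have htr : (S.toMatrix * Xb.toMatrix).trace = 0 := by rw [← SymMat.inner_eq, hk.compl_S]
  have hpXb : SymMat.conj p Xb = Xb := by
    -- Complementarity makes the right side of the bound zero, so Xb lies in the face exposed by S.
    have h1 := norm_sub_conj_sq_le hr hpt hpp hle hk.psd
    rw [htr, mul_zero] at h1
    have h2 := le_antisymm (nonpos_of_mul_nonpos_right h1 hr) (sq_nonneg _)
    rw [pow_eq_zero_iff two_ne_zero, norm_eq_zero, sub_eq_zero] at h2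
    exact h2.symm
  have hreg : FaceRegular p Xb := by
    rcases hrank with h | h
    · exact faceRegular_of_le_rank_add_one hpt hSp hk.psd hpXb h
    · exact faceRegular_of_rank_add_rank hpt hSp hk.psd_S hk.psd hpXb htr h
  obtain ⟨M, hM, hdist⟩ :=
    hk.exists_infDist_sq_le hP hgrowth hr hpt hpp hSp hle hreg hpXb X₀
  obtain ⟨κ, hκ, N, hN, hgr⟩ := hgrowth _ hk.dom
  have hFc : Continuous P.F := P.F.continuous_of_finiteDimensional
  have hF₀ : P.F X₀ = P.F Xb := hk.map_F_eq_of_mem hP hgrowth hX₀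
  have hU : P.F ⁻¹' (N ∩ effDomain P.h) ∈ 𝓝 X₀ := by
    refine hFc.continuousAt.preimage_mem_nhds ?_
    rw [hF₀]
    exact Filter.inter_mem hN (hP.dom_open.mem_nhds hk.dom)
  -- The gap dominates κ times the first term of g and 1 times the other two. Dividing by M + 1
  -- below allows for M = 0.
  set k := min κ 1 with hkdef
  have hk0 : 0 < k := lt_min hκ one_pos
  refine ⟨k / (M + 1), by positivity, _,
    Filter.inter_mem hU (Metric.closedBall_mem_nhds X₀ one_pos), fun X hX => ⟨hX.1.2, ?_⟩⟩
  intro hpsd hA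
  have h1 := hdist X hX.2 hpsd hA
  have h2 := hgr _ hX.1.1
  rw [← hP.coe_toReal hk.dom, ← hP.coe_toReal hX.1.2, ← EReal.coe_add, EReal.coe_le_coe_iff,
    hk.fderiv_eq] at h2
  have h3 := hk.realObjective_sub X
  have h4 := hk.inner_nonpos hA
  have h5 := inner_nonneg_of_mem_psdCone hk.psd_S hpsd
  set g := ‖P.F X - P.F Xb‖ ^ 2 + -⟪y, P.b - P.A X⟫ + ⟪S, X⟫ with hg
  have hg0 : 0 ≤ g := by
    have := sq_nonneg ‖P.F X - P.F Xb‖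
    linarith
  have h6 : k * g ≤ κ * ‖P.F X - P.F Xb‖ ^ 2 + -⟪y, P.b - P.A X⟫ + ⟪S, X⟫ := by
    have e1 : k * ‖P.F X - P.F Xb‖ ^ 2 ≤ κ * ‖P.F X - P.F Xb‖ ^ 2 :=
      mul_le_mul_of_nonneg_right (min_le_left _ _) (sq_nonneg _)
    have e2 := mul_le_mul_of_nonneg_right (min_le_right κ 1) (neg_nonneg.2 h4)
    have e3 := mul_le_mul_of_nonneg_right (min_le_right κ 1) h5
    rw [hg, mul_add, mul_add]
    linarith
  have h7 : k / (M + 1) * Metric.infDist X P.solutionSet ^ 2 ≤ k * g := by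
    rw [div_mul_eq_mul_div, div_le_iff₀ (by positivity), mul_assoc]
    refine mul_le_mul_of_nonneg_left ?_ hk0.le
    linarith
  linarith

theorem IsKKT.quadraticGrowthAt (hP : P.IsAdmissible) (hgrowth : P.LocalGrowth)
    (hk : P.IsKKT Xb y w S)
    (hrank : n ≤ S.toMatrix.rank + 1 ∨ Xb.toMatrix.rank + S.toMatrix.rank = n)
    {X₀ : SymMat n} (hX₀ : X₀ ∈ P.solutionSet) : P.QuadraticGrowthAt X₀ := by
  obtain ⟨κ, hκ, U, hU, hgr⟩ := hk.exists_quadratic_growth hP hgrowth hrank hX₀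
  refine ⟨κ, hκ, U, hU, fun X hX => ?_⟩
  rcases eq_or_ne (P.objective X) ⊤ with htop | htop
  · rw [htop]; exact le_top
  obtain ⟨hpsd, hF⟩ := hP.mem_of_objective_lt_top (lt_top_iff_ne_top.2 htop)
  obtain ⟨hpsd₀, hF₀⟩ := hP.mem_of_objective_lt_top hX₀.2.1
  rw [hP.objective_eq hpsd hF, hP.objective_eq hpsd₀ hF₀,
    hk.realObjective_eq_of_mem hP hgrowth hX₀, ← EReal.coe_add, EReal.coe_le_coe_iff]
  exact (hgr X hX.1).2 hpsd hX.2

/-- Quadratic growth gives metric subregularity, by the supergradient inequality. -/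
theorem IsKKT.metricallySubregularAt (hP : P.IsAdmissible) (hgrowth : P.LocalGrowth)
    (hk : P.IsKKT Xb y w S)
    (hrank : n ≤ S.toMatrix.rank + 1 ∨ Xb.toMatrix.rank + S.toMatrix.rank = n)
    {X₀ : SymMat n} (hX₀ : X₀ ∈ P.solutionSet) : MetricallySubregularAt P.Tphi X₀ 0 := by
  have hset := hk.setOf_zero_mem_Tphi hP hgrowth
  have h0 : 0 ∈ P.Tphi X₀ := by
    rw [← hset] at hX₀
    exact hX₀
  obtain ⟨κ, hκ, U, hU, hgr⟩ := hk.exists_quadratic_growth hP hgrowth hrank hX₀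
  refine ⟨h0, Real.toNNReal κ⁻¹, Real.toNNReal_pos.2 (inv_pos.2 hκ), U, hU, fun X hX => ?_⟩
  rw [hset]
  have hne : P.solutionSet.Nonempty := ⟨X₀, hX₀⟩
  have key : ∀ V ∈ P.Tphi X, Metric.infDist X P.solutionSet ≤ κ⁻¹ * ‖V‖ := by
    intro V hV
    have hsup : ∀ Z, P.phi Z ≤ P.phi X + ((⟪-V, Z - X⟫ : ℝ) : EReal) := hV
    -- A supergradient at a point where φ = -∞ would force φ(X₀) = -∞.
    have hbot : P.phi X ≠ ⊥ := by
      intro hb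
      have := hsup X₀
      rw [hb, EReal.bot_add, hk.phi_eq_of_mem hP hgrowth hX₀, le_bot_iff] at this
      exact EReal.coe_ne_bot _ this
    obtain ⟨hpsd, hA⟩ := mem_of_phi_ne_bot hP hgrowth hbot
    obtain ⟨hF, hq⟩ := hgr X hX
    have hq := hq hpsd hA
    rw [phi_eq hP hgrowth hpsd hF hA] at hsup
    set d := Metric.infDist X P.solutionSet with hd
    have hd0 : 0 ≤ d := Metric.infDist_nonneg
    have hdist : ∀ Z ∈ P.solutionSet, κ * d ^ 2 ≤ ‖V‖ * dist X Z := by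
      intro Z hZ
      have h1 := hsup Z
      rw [hk.phi_eq_of_mem hP hgrowth hZ, ← EReal.coe_add, EReal.coe_le_coe_iff] at h1
      have h2 := real_inner_le_norm (-V) (Z - X)
      rw [norm_neg] at h2
      rw [dist_comm, dist_eq_norm]
      linarith
    -- Near-minimizers of the distance replace a nearest point, so closedness of Ω is not needed.
    have hle : κ * d ^ 2 ≤ ‖V‖ * d := by
      refine le_of_forall_pos_le_add fun ε hε => ?_
      obtain ⟨Z, hZ, hXZ⟩ := (Metric.infDist_lt_iff (x := X) hne).1
        (show d < d + ε / (‖V‖ + 1) from lt_add_of_pos_right _ (by positivity))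
      have h1 := (hdist Z hZ).trans (mul_le_mul_of_nonneg_left hXZ.le (norm_nonneg V))
      have h2 : ‖V‖ * (ε / (‖V‖ + 1)) ≤ ε := by
        rw [mul_div_assoc', div_le_iff₀ (by positivity)]
        nlinarith [norm_nonneg V]
      linarith
    rw [inv_mul_eq_div, le_div_iff₀ hκ]
    rcases hd0.eq_or_lt with h | h
    · rw [← h, zero_mul]; exact norm_nonneg V
    · refine le_of_mul_le_mul_right ?_ h
      linarith
  rw [mul_comm]
  -- In divided form the bound is checked against each V ∈ T_φ(X) separately, so that an empty
  -- T_φ(X), at distance ⊤, needs no separate case.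
  refine (ENNReal.div_le_iff_le_mul (Or.inl ?_) (Or.inl ENNReal.coe_ne_top)).1
    (Metric.le_infEDist.2 fun V hV => ?_)
  · exact ENNReal.coe_ne_zero.2 (Real.toNNReal_pos.2 (inv_pos.2 hκ)).ne'
  · refine (ENNReal.div_le_iff_le_mul (Or.inl ?_) (Or.inl ENNReal.coe_ne_top)).2 ?_
    · exact ENNReal.coe_ne_zero.2 (Real.toNNReal_pos.2 (inv_pos.2 hκ)).ne'
    · have h1 := ENNReal.ofReal_le_ofReal (key V hV)
      rw [Metric.infDist, ENNReal.ofReal_toReal (Metric.infEDist_ne_top hne), mul_comm,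
        ENNReal.ofReal_mul (norm_nonneg V)] at h1
      rw [edist_comm, edist_zero_right, ← ofReal_norm]
      exact h1

end Growth

end Problem

end ConvexSDP

theorem mainTheorem3 {n : ℕ} {Y W : Type*}
    [NormedAddCommGroup Y] [InnerProductSpace ℝ Y] [FiniteDimensional ℝ Y]
    [NormedAddCommGroup W] [InnerProductSpace ℝ W] [FiniteDimensional ℝ W]
    (P : ConvexSDP.Problem n Y W) (hP : P.IsAdmissible) (hgrowth : P.LocalGrowth)
    (hcond :
      (∃ X ∈ P.solutionSet, ∃ y w S, (y, w, S) ∈ P.multipliers X ∧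
        n ≤ S.toMatrix.rank + 1) ∨
      (∃ X ∈ P.solutionSet, ∃ y w S, (y, w, S) ∈ P.multipliers X ∧
        X.toMatrix.rank + S.toMatrix.rank = n)) :
    {X | 0 ∈ P.Tphi X} = P.solutionSet ∧
    ∀ X ∈ P.solutionSet,
      ConvexSDP.MetricallySubregularAt P.Tphi X 0 ∧ P.QuadraticGrowthAt X := by
  obtain ⟨Xb, y, w, S, hk, hrank⟩ : ∃ Xb y w S, P.IsKKT Xb y w S ∧
      (n ≤ S.toMatrix.rank + 1 ∨ Xb.toMatrix.rank + S.toMatrix.rank = n) := by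
    rcases hcond with ⟨X, hX, y, w, S, hz, hr⟩ | ⟨X, hX, y, w, S, hz, hr⟩
    · exact ⟨X, y, w, S, ConvexSDP.Problem.isKKT_of_mem_multipliers hP hgrowth hX hz, Or.inl hr⟩
    · exact ⟨X, y, w, S, ConvexSDP.Problem.isKKT_of_mem_multipliers hP hgrowth hX hz, Or.inr hr⟩
  exact ⟨hk.setOf_zero_mem_Tphi hP hgrowth, fun X hX =>
    ⟨hk.metricallySubregularAt hP hgrowth hrank hX, hk.quadraticGrowthAt hP hgrowth hrank hX⟩⟩
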